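/- Let $N\ge 1$, let $U$ be a unitary on $N$ qubits (for instance $U=U(t)=e^{-iHt}$), let $i,j$ be two (possibly equal) sites, and write $Z_i$ for the Pauli $Z$ operator on site $i$, $B_i(\varphi)=e^{-i\varphi Z_i}$, $M_j(\varphi)=e^{-i\varphi Z_j}$. For $d\ge 0$ and real phases $\vec\phi=(\phi_0,\dots,\phi_{2d})$ define the $d$-layer QSP-OTOC $$\mathrm{QSP\text{-}OTOC}^{(d)}_{i,j}(U,\vec\phi)=\langle 0^N|\,B_i(\phi_{2d})\,C^{(0)}C^{(1)}\cdots C^{(d-1)}\,|0^N\rangle,\qquad C^{(r)}=U^\dagger B_i(\phi_{2r+1})\,U\,M_j(\phi_{2r}).$$ Let $A_{i,j}=\langle 0_i|U|0_j\rangle$ be the truncated propagator, a linear map from the states of the $N-1$ qubits other than $j$ to the states of the $N-1$ qubits other than $i$. It has a singular value decomposition $A_{i,j}|v_l\rangle=\lambda_l|w_l\rangle$, $l=1,\dots,2^{N-1}$, with $\lambda_l\ge 0$ and orthonormal bases $(v_l)$ and $(w_l)$; for any such decomposition put $\alpha_l=\langle v_l|0^{N-1}\rangle$. There are polynomials $P_{d,\vec\phi}\in\mathbb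 C[x]$, depending only on $d$ and $\vec\phi$ (and not on $N,i,j,U$), with the following properties. 1. $P_{d,\vec\phi}$ has degree at most $2d$, is even, satisfies $|P_{d,\vec\phi}(x)|\le 1$ for $x\in[-1,1]$, and is given by the single-qubit sequence: for all real $\theta$, with $R_\theta=e^{-i(\theta/2)Y}$, $$P_{d,\vec\phi}(\cos(\theta/2))=\langle 0|\,e^{-i\phi_{2d}Z}\prod_{r=0}^{d-1}\bigl(R_\theta^\dagger e^{-i\phi_{2r+1}Z}R_\theta e^{-i\phi_{2r}Z}\bigr)|0\rangle,$$ where the factors are ordered from left to right by increasing $r$. 2. For all $N,i,j,U$, every singular value decomposition of $A_{i,j}$ as above, and all $d,\vec\phi$, $$\mathrm{QSP\text{-}OTOC}^{(d)}_{i,j}(U,\vec\phi)=\sum_l|\alpha_l|^2\,P_{d,\vec\phi}(\lambda_l).$$ 3. Let $p$ be any real even polynomial of degree at most $2d$ with $|p(x)|\le 1$ for $x\in[-1,1]$. Then there are phases $\vec\phi$ such that $\operatorname{Re}P_{d,\vec\phi}(x)=p(x)$ for all real $x$, and hence $\operatorname{Re}\,\mathrm{QSP\text{-}OTOC}^{(d)}_{i,j}(U,\vec\phi)=\sum_l|\alpha_l|^2p(\lambda_l)$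 for all $N,i,j,U$. If moreover $|p(x)|\ge 1$ for all real $x$ with $|x|\ge 1$ and $|p(ix)|\ge 1$ for all real $x$, then there are phases $\vec\phi$ such that $P_{d,\vec\phi}=p$ exactly, and hence $\mathrm{QSP\text{-}OTOC}^{(d)}_{i,j}(U,\vec\phi)=\sum_l|\alpha_l|^2p(\lambda_l)$ for all $N,i,j,U$. -/

import Mathlib

open scoped Matrix Polynomial

namespace QSPOTOC

noncomputable section

/-- Computational basis labels of a register whose qubits are indexed by `S`. -/
abbrev Bits (S : Type) : Type := S → Fin 2

/-- The qubits of an `N`-qubit register other than the qubit `i`. -/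
abbrev Others {N : ℕ} (i : Fin N) : Type := {k : Fin N // k ≠ i}

/-- Operators on `N` qubits, as matrices in the computational basis. -/
abbrev QubitOp (N : ℕ) : Type := Matrix (Bits (Fin N)) (Bits (Fin N)) ℂ

/-- The Pauli matrix `Z`. -/
def pauliZ : Matrix (Fin 2) (Fin 2) ℂ := !![1, 0; 0, -1]

/-- The Pauli matrix `Y`. -/
def pauliY : Matrix (Fin 2) (Fin 2) ℂ := !![0, -Complex.I; Complex.I, 0]

/-- The single-qubit operator `P` acting on the qubit `i`, and the identity on the others. -/
def onSite {N : ℕ} (i : Fin N) (P : Matrix (Fin 2) (Fin 2) ℂ) : QubitOp N :=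
  fun a b => if ∀ k, k ≠ i → a k = b k then P (a i) (b i) else 0

/-- The phase rotation `e^{-i φ Z_i}` on the qubit `i` (used both for `B_i(φ)` and `M_j(φ)`). -/
def phaseRot {N : ℕ} (i : Fin N) (φ : ℝ) : QubitOp N :=
  NormedSpace.exp ((-(Complex.I * (φ : ℂ))) • onSite i pauliZ)

/-- The generalized echo operator `U† B_i(φ') U M_j(φ)`. -/
def echo {N : ℕ} (i j : Fin N) (U : QubitOp N) (φ' φ : ℝ) : QubitOp N :=
  Uᴴ * phaseRot i φ' * U * phaseRot j φ

/-- The `d`-layer QSP-OTOC with phases `φ₀, …, φ_{2d}`: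
`⟨0^N| B_i(φ_{2d}) C⁽⁰⁾ C⁽¹⁾ ⋯ C⁽ᵈ⁻¹⁾ |0^N⟩`, where
`C⁽ʳ⁾ = U† B_i(φ_{2r+1}) U M_j(φ_{2r})`. -/
def qspOTOC {N : ℕ} (i j : Fin N) (U : QubitOp N) (d : ℕ) (φ : Fin (2 * d + 1) → ℝ) : ℂ :=
  (phaseRot i (φ (Fin.last (2 * d))) *
    (List.ofFn fun r : Fin d =>
      echo i j U (φ ⟨2 * r + 1, by omega⟩) (φ ⟨2 * r, by omega⟩)).prod) 0 0

/-- `|0_j⟩`, the isometry that adjoins the qubit `j` in the state `|0⟩` to the other qubits. -/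
def ketZero {N : ℕ} (j : Fin N) : Matrix (Bits (Fin N)) (Bits (Others j)) ℂ :=
  fun a b => if a j = 0 ∧ ∀ k : Others j, a k = b k then 1 else 0

/-- The spatially resolved truncated propagator `A_{i,j} = ⟨0_i| U |0_j⟩`. -/
def truncProp {N : ℕ} (i j : Fin N) (U : QubitOp N) :
    Matrix (Bits (Others i)) (Bits (Others j)) ℂ :=
  (ketZero i)ᴴ * U * ketZero j

/-- `A` as a linear map between the Hilbert spaces of the two truncated registers. -/
def truncPropLin {N : ℕ} (i j : Fin N) (U : QubitOp N) :
    EuclideanSpace ℂ (Bits (Others j)) →ₗ[ℂ] EuclideanSpace ℂ (Bits (Others i)) :=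
  Matrix.toEuclideanLin (truncProp i j U)

/-- The state `|0^{N-1}⟩` of the qubits other than `j`. -/
def zeroState {N : ℕ} (j : Fin N) : EuclideanSpace ℂ (Bits (Others j)) :=
  EuclideanSpace.single (0 : Bits (Others j)) (1 : ℂ)

/-- `A v_l = σ_l w_l` with `σ_l ≥ 0` and orthonormal bases `v` (right singular vectors) and
`w` (left singular vectors): a singular value decomposition of `A`. -/
def IsSVD {ι E F : Type*} [Fintype ι]
    [NormedAddCommGroup E] [InnerProductSpace ℂ E]
    [NormedAddCommGroup F] [InnerProductSpace ℂ F]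
    (A : E →ₗ[ℂ] F) (σ : ι → ℝ) (w : OrthonormalBasis ι ℂ F) (v : OrthonormalBasis ι ℂ E) :
    Prop :=
  ∀ l, 0 ≤ σ l ∧ A (v l) = (σ l : ℂ) • w l

/-- The weight `|α_l|² = |⟨v_l | 0^{N-1}⟩|²` of the reference state on the singular vector `v_l`. -/
def weight {N : ℕ} {j : Fin N} {ι : Type*} [Fintype ι]
    (v : OrthonormalBasis ι ℂ (EuclideanSpace ℂ (Bits (Others j)))) (l : ι) : ℝ :=
  ‖inner ℂ (v l) (zeroState j)‖ ^ 2

/-- The signal rotation `e^{-i(θ/2)Y}` of the two-dimensional sector with `λ = cos(θ/2)`. -/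
def signalRot (θ : ℝ) : Matrix (Fin 2) (Fin 2) ℂ :=
  NormedSpace.exp ((-(Complex.I * ((θ / 2 : ℝ) : ℂ))) • pauliY)

/-- The single-qubit phase rotation `e^{-iφZ}`. -/
def qubitRot (φ : ℝ) : Matrix (Fin 2) (Fin 2) ℂ :=
  NormedSpace.exp ((-(Complex.I * (φ : ℂ))) • pauliZ)

/-- The single-qubit QSP amplitude: `⟨0| · |0⟩` of the QSP-OTOC sequence in which `U` is replaced
by the signal rotation and all phase rotations act on the same qubit. -/
def qspAmplitude (d : ℕ) (φ : Fin (2 * d + 1) → ℝ) (θ : ℝ) : ℂ :=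
  (qubitRot (φ (Fin.last (2 * d))) *
    (List.ofFn fun r : Fin d =>
      (signalRot θ)ᴴ * qubitRot (φ ⟨2 * r + 1, by omega⟩) *
        signalRot θ * qubitRot (φ ⟨2 * r, by omega⟩)).prod) 0 0

end

end QSPOTOC

namespace QSPOTOC

open Polynomial

/-! The spectral formula is a statement about two projections. With `E` the projection onto `|0⟩` at
site `j` and `F` the `U`-conjugate of the projection onto `|0⟩` at site `i`, every layer is a
rotation about `F` times a rotation about `E`. Compressing an alternating word by `E` gives a
polynomial in `T = E F E` whose coefficients depend only on the phases (`mul_projWord_mul`). On the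
range of `E`, `T` is the Gram matrix `A† A` of the truncated propagator, so the vectors `|0_j⟩ v_l`
are eigenvectors with eigenvalues `λ_l ^ 2`. Expanding the vacuum in them gives the sum
(`vacuum_amplitude`, `qspOTOC_eq_sum`). The single-qubit sequence is the same computation with `E`
of rank one, hence the same polynomial (`qspAmplitude_eq`). All polynomials are handled in the
variable `y = x ^ 2`, which makes evenness automatic.

For the converse, the first row of a single-qubit sequence is `(P(y), s c H(y))` with `s`, `c` the
sine and cosine and `y = c ^ 2`; unitarity reads `|P|² + y (1 - y) |H|² = 1`. Any such pair with the
right degrees can be peeled back to a phase sequence, since equality of the leading moduli allows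
each phase to cancel the top coefficients (`exists_odd_of_even`, `exists_even_of_odd`,
`exists_phases`).

It remains to complete a target `g(y) = p(x)`. For a prescribed real part, Markov–Lukács
(`exists_lukacs`) writes `1 - g² = b² + y (1 - y) h²`, and `P = g + i b`, `H = h` works. For `P = g`
exactly, the growth conditions make `(1 - g²) / (y (1 - y))` a polynomial that is nonnegative on the
line, hence of the form `|h|²` (`exists_mul_conj_of_nonneg`). -/

/-! ### Nonnegative real polynomials as sums of squares and squared moduli. -/

theorem eval_nonneg_of_mem_closure {S : Set ℝ} {f : ℝ[X]} (hf : ∀ x ∈ S, 0 ≤ f.eval x) {x : ℝ}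
    (hx : x ∈ closure S) : 0 ≤ f.eval x :=
  closure_minimal (t := {x | 0 ≤ f.eval x}) hf
    (isClosed_le continuous_const f.continuous) hx

/-- When a factor `g` that vanishes at `r` is divided out, the sign of the cofactor is visible only
away from `r`; density and continuity recover the rest of the interval. -/
theorem Icc_subset_closure_Ioo_diff (r : ℝ) :
    Set.Icc (0 : ℝ) 1 ⊆ closure (Set.Ioo 0 1 ∩ {r}ᶜ) := by
  have h : Set.Ioo (0 : ℝ) 1 ⊆ closure (Set.Ioo 0 1 ∩ {r}ᶜ) :=
    (dense_compl_singleton r).open_subset_closure_inter isOpen_Ioo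
  have h2 := closure_minimal h isClosed_closure
  rwa [closure_Ioo zero_ne_one] at h2

/-- The root is a local minimum, so the derivative vanishes there as well. -/
theorem sq_dvd_of_eventually_nonneg {f : ℝ[X]} (hf : f ≠ 0) {r : ℝ} (hr : f.eval r = 0)
    (h : ∀ᶠ x in nhds r, 0 ≤ f.eval x) : (X - C r) ^ 2 ∣ f := by
  have hmin : IsLocalMin (fun x => f.eval x) r := by
    filter_upwards [h] with x hx
    simpa [hr] using hx
  have hd := hmin.deriv_eq_zero
  rw [Polynomial.deriv] at hd
  have h1 : 1 < f.rootMultiplicity r :=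
    (one_lt_rootMultiplicity_iff_isRoot hf).2 ⟨hr, hd⟩
  exact (pow_dvd_pow _ h1).trans (pow_rootMultiplicity_dvd f r)

/-- A real quadratic with the non-real root `z`. -/
theorem eval_quadratic_pos {z : ℂ} (hz : z.im ≠ 0) (x : ℝ) :
    0 < (X ^ 2 - C (2 * z.re) * X + C (‖z‖ ^ 2) : ℝ[X]).eval x := by
  have : 0 < z.im ^ 2 := by positivity
  simp only [eval_add, eval_sub, eval_mul, eval_pow, eval_X, eval_C, Complex.sq_norm,
    Complex.normSq_apply]
  nlinarith [sq_nonneg (x - z.re)]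

theorem natDegree_quadratic (a b : ℝ) : (X ^ 2 - C a * X + C b : ℝ[X]).natDegree = 2 := by
  compute_degree!

theorem exists_real_root {f : ℝ[X]} (hf : f.natDegree ≠ 0)
    (h : ∀ z : ℂ, aeval z f = 0 → z.im = 0) : ∃ r : ℝ, f.eval r = 0 := by
  obtain ⟨z, hz⟩ := IsAlgClosed.exists_aeval_eq_zero ℂ f
    (fun h0 => hf (natDegree_eq_of_degree_eq_some h0))
  have him := h z hz
  refine ⟨z.re, ?_⟩
  have hz' : z = ((z.re : ℝ) : ℂ) := by
    apply Complex.ext <;> simp [him]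
  rw [hz'] at hz
  have := aeval_algebraMap_apply ℂ z.re f
  rw [Complex.coe_algebraMap, hz] at this
  simpa using this.symm

/-- A polynomial of degree at least three that is nonnegative on `[0, 1]` has a quadratic factor
that is nonnegative there. -/
theorem exists_quadratic_factor {f : ℝ[X]} (hdeg : 3 ≤ f.natDegree)
    (hf : ∀ x ∈ Set.Icc (0 : ℝ) 1, 0 ≤ f.eval x) :
    ∃ g k : ℝ[X], f = g * k ∧ g.natDegree = 2 ∧
      ∃ r : ℝ, ∀ x ∈ Set.Ioo (0 : ℝ) 1 ∩ {r}ᶜ, 0 < g.eval x := by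
  have hf0 : f ≠ 0 := by rintro rfl; simp at hdeg
  by_cases hz : ∃ z : ℂ, aeval z f = 0 ∧ z.im ≠ 0
  · obtain ⟨z, hz, him⟩ := hz
    obtain ⟨k, hk⟩ := quadratic_dvd_of_aeval_eq_zero_im_ne_zero f hz him
    exact ⟨_, k, hk, natDegree_quadratic _ _, 0, fun x _ => eval_quadratic_pos him x⟩
  push Not at hz
  by_cases hr : ∃ r ∈ Set.Ioo (0 : ℝ) 1, f.eval r = 0
  · obtain ⟨r, hr, hr0⟩ := hr
    obtain ⟨k, hk⟩ := sq_dvd_of_eventually_nonneg hf0 hr0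
      (by filter_upwards [isOpen_Ioo.mem_nhds hr] with x hx using hf x ⟨hx.1.le, hx.2.le⟩)
    refine ⟨_, k, hk, by compute_degree!, r, fun x hx => ?_⟩
    have : x - r ≠ 0 := sub_ne_zero.2 hx.2
    simp only [eval_pow, eval_sub, eval_X, eval_C]
    positivity
  push Not at hr
  obtain ⟨r, hr0⟩ := exists_real_root (by omega) hz
  obtain ⟨f1, hf1⟩ := dvd_iff_isRoot.2 hr0
  have hf10 : f1 ≠ 0 := by rintro rfl; simp [hf1] at hf0
  have hd1 : f.natDegree = 1 + f1.natDegree := by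
    rw [hf1, natDegree_mul (X_sub_C_ne_zero r) hf10, natDegree_X_sub_C]
  obtain ⟨s, hs0⟩ := exists_real_root (f := f1) (by omega)
    (fun z h => hz z (by rw [hf1, map_mul, h, mul_zero]))
  obtain ⟨k, hk⟩ := dvd_iff_isRoot.2 hs0
  have hrn : r ∉ Set.Ioo (0 : ℝ) 1 := fun h => hr r h hr0
  have hsn : s ∉ Set.Ioo (0 : ℝ) 1 := fun h => hr s h (by rw [hf1, eval_mul, hs0, mul_zero])
  -- All roots are now real and outside the open interval, so a product of two linear factors has
  -- constant sign there; `e = ±1` corrects it and is absorbed into the cofactor.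
  have key : ∃ e : ℝ, e * e = 1 ∧ ∀ x ∈ Set.Ioo (0 : ℝ) 1, 0 < e * ((x - r) * (x - s)) := by
    simp only [Set.mem_Ioo, not_and_or, not_lt] at hrn hsn
    rcases hrn with h1 | h1 <;> rcases hsn with h2 | h2
    · exact ⟨1, by norm_num, fun x hx => by
        have := mul_pos (by linarith [hx.1] : 0 < x - r) (by linarith [hx.1] : 0 < x - s)
        linarith⟩
    · exact ⟨-1, by norm_num, fun x hx => by
        have := mul_pos (by linarith [hx.1] : 0 < x - r) (by linarith [hx.2] : 0 < s - x)
        linarith⟩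
    · exact ⟨-1, by norm_num, fun x hx => by
        have := mul_pos (by linarith [hx.2] : 0 < r - x) (by linarith [hx.1] : 0 < x - s)
        linarith⟩
    · exact ⟨1, by norm_num, fun x hx => by
        have := mul_pos (by linarith [hx.2] : 0 < r - x) (by linarith [hx.2] : 0 < s - x)
        linarith⟩
  obtain ⟨e, he, hpos⟩ := key
  have heC : (C e * C e : ℝ[X]) = 1 := by rw [← C_mul, he, C_1]
  refine ⟨C e * ((X - C r) * (X - C s)), C e * k, ?_, ?_, 0, fun x hx => ?_⟩
  · rw [hf1, hk]
    linear_combination (-(X - C r) * (X - C s) * k) * heC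
  · have : e ≠ 0 := by rintro rfl; simp at he
    rw [natDegree_C_mul this, natDegree_mul (X_sub_C_ne_zero r) (X_sub_C_ne_zero s)]
    simp
  · simpa using hpos x hx.1

/-- With `u² = f(1)` and `v² = f(0)`, one has `f = u² x² + m x (1 - x) + v² (1 - x)²` for `m = a1 +
2 a0`. Completing the square as `(u x - v (1 - x))²` leaves `(m + 2 u v) x (1 - x)`, so everything
rests on `m + 2 u v ≥ 0`. -/
theorem lukacs_quadratic {f : ℝ[X]} (hdeg : f.natDegree ≤ 2)
    (hf : ∀ x ∈ Set.Icc (0 : ℝ) 1, 0 ≤ f.eval x) :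
    ∃ (b : ℝ[X]) (h : ℝ), b.natDegree ≤ 1 ∧ f = b ^ 2 + X * (1 - X) * C h ^ 2 := by
  obtain ⟨a2, a1, a0, hfe⟩ : ∃ a2 a1 a0 : ℝ, f = C a2 * X ^ 2 + C a1 * X + C a0 :=
    ⟨_, _, _, eq_quadratic_of_degree_le_two (natDegree_le_iff_degree_le.1 hdeg)⟩
  have hev : ∀ x, f.eval x = a2 * x ^ 2 + a1 * x + a0 := fun x => by simp [hfe]
  have h0 := hf 0 (by simp)
  have h1 := hf 1 (by simp)
  rw [hev] at h0 h1
  set u := √(a2 + a1 + a0) with hu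
  set v := √a0 with hv
  have hu2 : u ^ 2 = a2 + a1 + a0 := Real.sq_sqrt (by linarith)
  have hv2 : v ^ 2 = a0 := Real.sq_sqrt (by linarith)
  have hu0 : 0 ≤ u := Real.sqrt_nonneg _
  have hv0 : 0 ≤ v := Real.sqrt_nonneg _
  have hg : 0 ≤ a1 + 2 * a0 + 2 * (u * v) := by
    -- The substitution `x = t / (1 + t)` carries the half-line into the interval.
    have hpos : ∀ t : ℝ, 0 ≤ t → 0 ≤ u ^ 2 * (t * t) + (a1 + 2 * a0) * t + v ^ 2 := by
      intro t ht
      have hx := hf (t / (1 + t)) ⟨by positivity, by rw [div_le_one (by positivity)]; linarith⟩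
      rw [hev] at hx
      have e : a2 * (t / (1 + t)) ^ 2 + a1 * (t / (1 + t)) + a0
          = (u ^ 2 * (t * t) + (a1 + 2 * a0) * t + v ^ 2) / (1 + t) ^ 2 := by
        rw [hu2, hv2]
        field_simp
        ring
      rw [e] at hx
      by_contra! hlt
      exact absurd hx (not_le.2 (div_neg_of_neg_of_pos hlt (by positivity)))
    by_contra! hneg
    have huv := mul_nonneg hu0 hv0
    -- If the claim failed, the linear coefficient would be negative, so the quadratic would be
    -- nonnegative for `t ≤ 0` too; its discriminant then contradicts the failure.
    have hd := discrim_le_zero (a := u ^ 2) (b := a1 + 2 * a0) (c := v ^ 2) fun t => by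
      rcases le_total 0 t with ht | ht
      · exact hpos t ht
      · have := mul_nonneg_of_nonpos_of_nonpos (by linarith : a1 + 2 * a0 ≤ 0) ht
        have := mul_nonneg (sq_nonneg u) (mul_self_nonneg t)
        have := sq_nonneg v
        linarith
    rw [discrim] at hd
    nlinarith
  refine ⟨C (u + v) * X - C v, √(a1 + 2 * a0 + 2 * (u * v)), by compute_degree, ?_⟩
  rw [← C_pow, Real.sq_sqrt hg, hfe]
  have e2 : a2 = u ^ 2 - a1 - v ^ 2 := by linarith
  rw [e2, ← hv2]
  simp only [C_add, C_sub, C_mul, C_pow, C_ofNat]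
  ring

/-- This is multiplicativity of the norm form of `b + h √(-X (1 - X))`. -/
theorem lukacs_mul {b₁ h₁ b₂ h₂ f g : ℝ[X]} (hf : f = b₁ ^ 2 + X * (1 - X) * h₁ ^ 2)
    (hg : g = b₂ ^ 2 + X * (1 - X) * h₂ ^ 2) :
    f * g = (b₁ * b₂ - X * (1 - X) * (h₁ * h₂)) ^ 2
      + X * (1 - X) * (b₁ * h₂ + b₂ * h₁) ^ 2 := by
  rw [hf, hg]
  ring

theorem natDegree_X_mul_one_sub_X : (X * (1 - X) : ℝ[X]).natDegree ≤ 2 := by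
  compute_degree

/-- The Markov–Lukács representation of polynomials of even degree nonnegative on `[0, 1]`. -/
theorem exists_lukacs (d : ℕ) : ∀ f : ℝ[X], f.natDegree ≤ 2 * d →
    (∀ x ∈ Set.Icc (0 : ℝ) 1, 0 ≤ f.eval x) →
    ∃ b h : ℝ[X], b.natDegree ≤ d ∧ h.degree < d ∧ f = b ^ 2 + X * (1 - X) * h ^ 2 := by
  induction d with
  | zero =>
    intro f hdeg hf
    obtain ⟨c, rfl⟩ := natDegree_eq_zero.1 (Nat.le_zero.1 hdeg)
    have hc : 0 ≤ c := by simpa using hf 0 (by simp)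
    -- The bound on `degree`, unlike one on `natDegree`, forces `h = 0` when `d = 0`.
    refine ⟨C √c, 0, by simp, by simp, ?_⟩
    rw [← C_pow, Real.sq_sqrt hc]
    simp
  | succ d ih =>
    intro f hdeg hf
    by_cases h2 : f.natDegree ≤ 2
    · obtain ⟨b, h, hb, he⟩ := lukacs_quadratic h2 hf
      exact ⟨b, C h, by omega, degree_C_le.trans_lt (by exact_mod_cast d.succ_pos), he⟩
    obtain ⟨g, k, hgk, hg2, r, hpos⟩ := exists_quadratic_factor (by omega) hf
    have hg : ∀ x ∈ Set.Icc (0 : ℝ) 1, 0 ≤ g.eval x := fun x hx =>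
      eval_nonneg_of_mem_closure (fun x hx => (hpos x hx).le) (Icc_subset_closure_Ioo_diff r hx)
    have hk : ∀ x ∈ Set.Icc (0 : ℝ) 1, 0 ≤ k.eval x := by
      intro x hx
      refine eval_nonneg_of_mem_closure (fun x hx => ?_) (Icc_subset_closure_Ioo_diff r hx)
      have hfx := hf x ⟨hx.1.1.le, hx.1.2.le⟩
      rw [hgk, eval_mul] at hfx
      exact nonneg_of_mul_nonneg_right hfx (hpos x hx)
    have hg0 : g ≠ 0 := by rintro rfl; simp at hg2
    have hk0 : k ≠ 0 := by rintro rfl; simp [hgk] at h2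
    have hkd : k.natDegree ≤ 2 * d := by
      rw [hgk, natDegree_mul hg0 hk0] at hdeg
      omega
    obtain ⟨b₁, h₁, hb₁, he₁⟩ := lukacs_quadratic hg2.le hg
    obtain ⟨b₂, h₂, hb₂, hh₂, he₂⟩ := ih k hkd hk
    refine ⟨_, _, ?_, ?_, hgk.trans (lukacs_mul he₁ he₂)⟩
    · refine (natDegree_sub_le _ _).trans (max_le ?_ ?_)
      · exact natDegree_mul_le.trans (by omega)
      · by_cases hz : h₂ = 0
        · simp [hz]
        have := (natDegree_lt_iff_degree_lt hz).2 hh₂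
        have h3 := natDegree_X_mul_one_sub_X
        have h4 : (C h₁ * h₂).natDegree ≤ h₂.natDegree := natDegree_C_mul_le _ _
        exact natDegree_mul_le.trans (by omega)
    · refine (degree_add_le _ _).trans_lt (max_lt ?_ ?_)
      · by_cases hz : h₂ = 0
        · simp [hz, bot_lt_iff_ne_bot]
        have := (natDegree_lt_iff_degree_lt hz).2 hh₂
        have h4 : (b₁ * h₂).natDegree < d + 1 := natDegree_mul_le.trans_lt (by omega)
        exact degree_le_natDegree.trans_lt (by exact_mod_cast h4)
      · have h4 : (b₂ * C h₁).natDegree < d + 1 := (natDegree_mul_C_le _ _).trans_lt (by omega)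
        exact degree_le_natDegree.trans_lt (by exact_mod_cast h4)

/-- A real polynomial that is nonnegative on the real line is the squared modulus of a complex
polynomial. -/
theorem exists_mul_conj_of_nonneg (n : ℕ) : ∀ f : ℝ[X], f.natDegree ≤ n →
    (∀ x : ℝ, 0 ≤ f.eval x) →
    ∃ h : ℂ[X], f.map (algebraMap ℝ ℂ) = h * h.map (starRingEnd ℂ) := by
  induction n using Nat.strong_induction_on with
  | _ n ih =>
  intro f hdeg hf
  by_cases hd0 : f.natDegree = 0
  · obtain ⟨c, rfl⟩ := natDegree_eq_zero.1 hd0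
    have hc : 0 ≤ c := by simpa using hf 0
    refine ⟨C ((√c : ℝ) : ℂ), ?_⟩
    rw [map_C, map_C, ← C_mul, Complex.conj_ofReal, ← Complex.ofReal_mul, Real.mul_self_sqrt hc]
    rfl
  have hf0 : f ≠ 0 := by rintro rfl; simp at hd0
  -- Non-real roots come in conjugate pairs and real roots are at least double, so a factor `(X - z)
  -- (X - conj z)` always splits off, with a nonnegative cofactor.
  have key : ∃ (z : ℂ) (k : ℝ[X]), k.natDegree < f.natDegree ∧ (∀ x : ℝ, 0 ≤ k.eval x) ∧
      f.map (algebraMap ℝ ℂ) = (X - C z) * (X - C (starRingEnd ℂ z)) * k.map (algebraMap ℝ ℂ) := by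
    by_cases hz : ∃ z : ℂ, aeval z f = 0 ∧ z.im ≠ 0
    · obtain ⟨z, hz, him⟩ := hz
      obtain ⟨k, hk⟩ := quadratic_dvd_of_aeval_eq_zero_im_ne_zero f hz him
      have hk0 : k ≠ 0 := by rintro rfl; simp [hk] at hf0
      refine ⟨z, k, ?_, fun x => ?_, ?_⟩
      · have hq := natDegree_quadratic (2 * z.re) (‖z‖ ^ 2)
        rw [hk, natDegree_mul (by intro h; rw [h] at hq; simp at hq) hk0, hq]
        omega
      · have := hf x
        rw [hk, eval_mul] at this
        exact nonneg_of_mul_nonneg_right this (eval_quadratic_pos him x)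
      · rw [hk, Polynomial.map_mul]
        congr 1
        have h1 : C z + C (starRingEnd ℂ z) = (C ((2 * z.re : ℝ) : ℂ) : ℂ[X]) := by
          rw [← C_add, Complex.add_conj]
        have h2 : C z * C (starRingEnd ℂ z) = (C ((‖z‖ ^ 2 : ℝ) : ℂ) : ℂ[X]) := by
          rw [← C_mul, Complex.mul_conj, Complex.normSq_eq_norm_sq]
        simp only [Polynomial.map_add, Polynomial.map_sub, Polynomial.map_mul, Polynomial.map_pow,
          map_X, map_C, Complex.coe_algebraMap, ← h1, ← h2]
        ring
    · push Not at hz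
      obtain ⟨r, hr⟩ := exists_real_root hd0 hz
      obtain ⟨k, hk⟩ := sq_dvd_of_eventually_nonneg hf0 hr (Filter.Eventually.of_forall hf)
      have hk0 : k ≠ 0 := by rintro rfl; simp [hk] at hf0
      refine ⟨r, k, ?_, fun x => ?_, ?_⟩
      · rw [hk, natDegree_mul (pow_ne_zero _ (X_sub_C_ne_zero r)) hk0, natDegree_pow,
          natDegree_X_sub_C]
        omega
      · refine eval_nonneg_of_mem_closure (S := {r}ᶜ) (fun x hx => ?_) (dense_compl_singleton r x)
        have h := hf x
        have hx' : x - r ≠ 0 := sub_ne_zero.2 hx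
        rw [hk, eval_mul] at h
        refine nonneg_of_mul_nonneg_right h ?_
        simp only [eval_pow, eval_sub, eval_X, eval_C]
        positivity
      · rw [hk, Complex.conj_ofReal]
        simp [sq]
  obtain ⟨z, k, hkd, hk, he⟩ := key
  obtain ⟨h, hh⟩ := ih k.natDegree (by omega) k le_rfl hk
  refine ⟨(X - C z) * h, ?_⟩
  rw [he, hh]
  simp only [Polynomial.map_mul, Polynomial.map_sub, map_X, map_C]
  ring

/-! ### Peeling rotations off a normalized row. -/

/-- Coefficientwise complex conjugation. -/
noncomputable def conjPoly : ℂ[X] →+* ℂ[X] := mapRingHom (starRingEnd ℂ)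

@[simp] theorem conjPoly_X : conjPoly X = X := by simp [conjPoly]

@[simp] theorem conjPoly_C (z : ℂ) : conjPoly (C z) = C (starRingEnd ℂ z) := by simp [conjPoly]

theorem coeff_conjPoly (p : ℂ[X]) (n : ℕ) : (conjPoly p).coeff n = starRingEnd ℂ (p.coeff n) := by
  simp [conjPoly]

theorem natDegree_conjPoly_le (p : ℂ[X]) : (conjPoly p).natDegree ≤ p.natDegree :=
  natDegree_map_le

/-- The phase `e^{-iφ}`. -/
noncomputable def phase (φ : ℝ) : ℂ := Complex.exp (-(Complex.I * φ))

theorem phase_mul_phase_neg (φ : ℝ) : phase φ * phase (-φ) = 1 := by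
  rw [phase, phase, ← Complex.exp_add]
  simp

theorem conj_phase (φ : ℝ) : starRingEnd ℂ (phase φ) = phase (-φ) := by
  rw [phase, phase, ← Complex.exp_conj]
  simp

theorem C_phase_mul (φ : ℝ) : (C (phase φ) * C (phase (-φ)) : ℂ[X]) = 1 := by
  rw [← C_mul, phase_mul_phase_neg, C_1]

theorem exists_phase_eq {z : ℂ} (hz : ‖z‖ = 1) : ∃ φ : ℝ, phase φ = z := by
  refine ⟨-Complex.arg z, ?_⟩
  have := Complex.norm_mul_exp_arg_mul_I z
  rw [hz, Complex.ofReal_one, one_mul] at this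
  rw [phase, ← this]
  push_cast
  rw [this, mul_neg, neg_neg, mul_comm, this]

/-- Numbers of equal modulus differ by a unit factor; half of its angle is put on each side. This
chooses the phase in every peeling step. -/
theorem exists_phase_balance {a b : ℂ} (h : ‖a‖ = ‖b‖) :
    ∃ φ : ℝ, phase (-φ) * a = phase φ * b := by
  by_cases ha : a = 0
  · have hb : b = 0 := by rw [← norm_eq_zero, ← h, ha, norm_zero]
    exact ⟨0, by rw [ha, hb, mul_zero, mul_zero]⟩
  have hb : b ≠ 0 := by rw [← norm_ne_zero_iff, ← h, norm_ne_zero_iff]; exact ha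
  obtain ⟨φ, hφ⟩ := exists_phase_eq (z := a / b)
    (by rw [norm_div, h, div_self (norm_ne_zero_iff.2 hb)])
  refine ⟨φ / 2, ?_⟩
  have h2 : phase (φ / 2) * phase (φ / 2) = phase φ := by
    rw [phase, phase, ← Complex.exp_add]
    push_cast
    ring_nf
  have h1 := phase_mul_phase_neg (φ / 2)
  have ha' : a = phase φ * b := by rw [hφ]; field_simp
  rw [ha', ← h2]
  linear_combination (phase (φ / 2) * b) * h1

theorem norm_eq_of_mul_conj_eq {a b : ℂ} (h : a * starRingEnd ℂ a = b * starRingEnd ℂ b) :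
    ‖a‖ = ‖b‖ := by
  rw [Complex.mul_conj, Complex.mul_conj, Complex.normSq_eq_norm_sq, Complex.normSq_eq_norm_sq]
    at h
  exact (sq_eq_sq₀ (norm_nonneg _) (norm_nonneg _)).1 (by exact_mod_cast h)

theorem natDegree_one_sub_X_le : (1 - X : ℂ[X]).natDegree ≤ 1 := by compute_degree

theorem coeff_one_sub_X : (1 - X : ℂ[X]).coeff 1 = -1 := by simp [coeff_one]

theorem coeff_mul_conjPoly {p : ℂ[X]} {d : ℕ} (hp : p.natDegree ≤ d) :
    (p * conjPoly p).coeff (d + d) = p.coeff d * starRingEnd ℂ (p.coeff d) := by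
  rw [coeff_mul_add_eq_of_natDegree_le hp ((natDegree_conjPoly_le p).trans hp), coeff_conjPoly]

theorem natDegree_mul_conjPoly_le {p : ℂ[X]} {d : ℕ} (hp : p.natDegree ≤ d) :
    (p * conjPoly p).natDegree ≤ d + d :=
  natDegree_mul_le_of_le hp ((natDegree_conjPoly_le p).trans hp)

/-- Peeling one signal rotation off an even row. -/
theorem exists_odd_of_even {d : ℕ} {P H : ℂ[X]} (hP : P.natDegree ≤ d + 1) (hH : H.natDegree ≤ d)
    (hn : P * conjPoly P + X * (1 - X) * (H * conjPoly H) = 1) :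
    ∃ (φ : ℝ) (p q : ℂ[X]), p.natDegree ≤ d ∧ q.natDegree ≤ d ∧
      X * (p * conjPoly p) + (1 - X) * (q * conjPoly q) = 1 ∧
      P = C (phase φ) * (X * p + (1 - X) * q) ∧ H = C (phase (-φ)) * (q - p) := by
  have hX : (X * (1 - X) : ℂ[X]).natDegree ≤ 1 + 1 :=
    natDegree_mul_le_of_le natDegree_X_le natDegree_one_sub_X_le
  have hXc : (X * (1 - X) : ℂ[X]).coeff (1 + 1) = -1 := by
    rw [coeff_mul_add_eq_of_natDegree_le natDegree_X_le natDegree_one_sub_X_le, coeff_one_sub_X]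
    simp
  -- Compare coefficients of degree `2 d + 2` in the normalization, where `X * (1 - X)` contributes
  -- `-1`.
  have hnorm : ‖P.coeff (d + 1)‖ = ‖-H.coeff d‖ := by
    rw [norm_neg]
    apply norm_eq_of_mul_conj_eq
    have h := congrArg (fun F => coeff F ((d + 1) + (d + 1))) hn
    have e : (d + 1) + (d + 1) = (1 + 1) + (d + d) := by ring
    simp only [coeff_add] at h
    rw [coeff_mul_conjPoly hP, e, coeff_mul_add_eq_of_natDegree_le hX
      (natDegree_mul_conjPoly_le hH),
      hXc,
      coeff_mul_conjPoly hH, coeff_one, if_neg (by omega)] at h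
    linear_combination h
  obtain ⟨φ, hφ⟩ := exists_phase_balance hnorm
  have hpp := C_phase_mul φ
  -- Both new entries have this form, with `F = X - 1` and `F = X`, so one phase lowers both
  -- degrees.
  have htop : ∀ F : ℂ[X], F.natDegree ≤ 1 → F.coeff 1 = 1 →
      (C (phase (-φ)) * P + F * (C (phase φ) * H)).natDegree ≤ d := by
    intro F hF hF1
    refine natDegree_le_pred (n := d + 1) ?_ ?_
    · refine natDegree_add_le_of_degree_le ((natDegree_C_mul_le _ _).trans hP) ?_
      rw [add_comm d 1]
      exact natDegree_mul_le_of_le hF ((natDegree_C_mul_le _ _).trans hH)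
    · have := coeff_mul_add_eq_of_natDegree_le hF ((natDegree_C_mul_le (phase φ) _).trans hH)
      rw [add_comm 1 d] at this
      rw [coeff_add, this, hF1, coeff_C_mul, coeff_C_mul, hφ]
      ring
  refine ⟨φ, C (phase (-φ)) * P + (X - 1) * (C (phase φ) * H),
    C (phase (-φ)) * P + X * (C (phase φ) * H), htop _ (by compute_degree) (by simp [coeff_one]),
    htop _ natDegree_X_le coeff_X_one, ?_, ?_, ?_⟩
  · simp only [map_add, map_sub, map_mul, conjPoly_X, conjPoly_C, map_one, conj_phase, neg_neg]
    linear_combination hn + (P * conjPoly P + X * (1 - X) * (H * conjPoly H)) * hpp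
  · linear_combination (-P) * hpp
  · linear_combination (-H) * hpp

/-- Peeling one signal rotation off an odd row. -/
theorem exists_even_of_odd {d : ℕ} {p q : ℂ[X]} (hp : p.natDegree ≤ d) (hq : q.natDegree ≤ d)
    (hn : X * (p * conjPoly p) + (1 - X) * (q * conjPoly q) = 1) :
    ∃ (φ : ℝ) (P H : ℂ[X]), P.natDegree ≤ d ∧ H.degree < d ∧
      P * conjPoly P + X * (1 - X) * (H * conjPoly H) = 1 ∧
      p = C (phase φ) * (P - (1 - X) * H) ∧ q = C (phase (-φ)) * (P + X * H) := by
  -- Compare coefficients of degree `2 d + 1`; the same phase then lowers the degrees of both `P`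
  -- and `H`.
  have hnorm : ‖p.coeff d‖ = ‖q.coeff d‖ := by
    apply norm_eq_of_mul_conj_eq
    have h := congrArg (fun F => coeff F (1 + (d + d))) hn
    simp only [coeff_add] at h
    rw [coeff_mul_add_eq_of_natDegree_le natDegree_X_le (natDegree_mul_conjPoly_le hp),
      coeff_mul_add_eq_of_natDegree_le natDegree_one_sub_X_le (natDegree_mul_conjPoly_le hq),
      coeff_mul_conjPoly hp, coeff_mul_conjPoly hq, coeff_one_sub_X, coeff_X_one, coeff_one,
      if_neg (by omega)] at h
    linear_combination h
  obtain ⟨φ, hφ⟩ := exists_phase_balance hnorm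
  have hpp := C_phase_mul φ
  have hp' := (natDegree_C_mul_le (phase (-φ)) p).trans hp
  have hq' := (natDegree_C_mul_le (phase φ) q).trans hq
  refine ⟨φ, X * (C (phase (-φ)) * p) + (1 - X) * (C (phase φ) * q),
    C (phase φ) * q - C (phase (-φ)) * p, ?_, ?_, ?_, ?_, ?_⟩
  · refine natDegree_le_pred (n := 1 + d) ?_ ?_ |>.trans (by omega)
    · exact natDegree_add_le_of_degree_le (natDegree_mul_le_of_le natDegree_X_le hp')
        (natDegree_mul_le_of_le natDegree_one_sub_X_le hq')
    · rw [coeff_add, coeff_mul_add_eq_of_natDegree_le natDegree_X_le hp',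
        coeff_mul_add_eq_of_natDegree_le natDegree_one_sub_X_le hq', coeff_one_sub_X, coeff_X_one,
        coeff_C_mul, coeff_C_mul, hφ]
      ring
  · rw [degree_lt_iff_coeff_zero]
    intro m hm
    rcases hm.eq_or_lt with rfl | hm
    · rw [coeff_sub, coeff_C_mul, coeff_C_mul, hφ, sub_self]
    · exact coeff_eq_zero_of_natDegree_lt
        ((natDegree_sub_le_of_le hq' hp').trans_lt (by simpa using hm))
  · simp only [map_add, map_sub, map_mul, conjPoly_X, conjPoly_C, map_one, conj_phase, neg_neg]
    linear_combination hn + (X * (p * conjPoly p) + (1 - X) * (q * conjPoly q)) * hpp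
  · linear_combination (-p) * hpp
  · linear_combination (-q) * hpp

/-! ### Explicit rotations and synthesis of phase sequences. -/

theorem qubitRot_eq (φ : ℝ) : qubitRot φ = !![phase φ, 0; 0, phase (-φ)] := by
  have h : (-(Complex.I * (φ : ℂ))) • pauliZ
      = Matrix.diagonal ![-(Complex.I * (φ : ℂ)), Complex.I * (φ : ℂ)] := by
    ext i j
    fin_cases i <;> fin_cases j <;> simp [pauliZ]
  rw [qubitRot, h, Matrix.exp_diagonal]
  ext i j
  fin_cases i <;> fin_cases j <;>
    simp [phase, Pi.exp_def, Complex.exp_eq_exp_ℂ]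

theorem diagonal_pair (a b : ℂ) : Matrix.diagonal ![a, b] = !![a, 0; 0, b] := by
  ext i j
  fin_cases i <;> fin_cases j <;> simp

theorem exp_pair (a b : ℂ) :
    NormedSpace.exp ![a, b] = ![NormedSpace.exp a, NormedSpace.exp b] := by
  rw [Pi.exp_def]
  ext i
  fin_cases i <;> rfl

theorem signalRot_eq (θ : ℝ) : signalRot θ =
    !![((Real.cos (θ / 2) : ℝ) : ℂ), -((Real.sin (θ / 2) : ℝ) : ℂ);
      ((Real.sin (θ / 2) : ℝ) : ℂ), ((Real.cos (θ / 2) : ℝ) : ℂ)] := by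
  -- The columns of `V` are the eigenvectors of `Y` for `1` and `-1`; `W` is the inverse.
  set V : Matrix (Fin 2) (Fin 2) ℂ := !![1, 1; Complex.I, -Complex.I] with hV
  set W : Matrix (Fin 2) (Fin 2) ℂ := !![1 / 2, -Complex.I / 2; 1 / 2, Complex.I / 2] with hW
  have hVW : V * W = 1 := by
    ext i j
    fin_cases i <;> fin_cases j <;> simp [hV, hW, Matrix.mul_apply, Fin.sum_univ_two] <;>
      ring_nf <;> simp
  have hinv : V⁻¹ = W := Matrix.inv_eq_right_inv hVW
  set t : ℂ := -(Complex.I * ((θ / 2 : ℝ) : ℂ)) with ht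
  have h : t • pauliY = V * Matrix.diagonal ![t, -t] * V⁻¹ := by
    rw [hinv, diagonal_pair]
    ext i j
    fin_cases i <;> fin_cases j
    all_goals simp [hV, hW, pauliY]
    all_goals ring
  have h1 : NormedSpace.exp t = Complex.cos ((θ / 2 : ℝ) : ℂ)
      - Complex.sin ((θ / 2 : ℝ) : ℂ) * Complex.I := by
    have := Complex.exp_mul_I (-((θ / 2 : ℝ) : ℂ))
    rw [Complex.cos_neg, Complex.sin_neg] at this
    rw [← Complex.exp_eq_exp_ℂ, ht, mul_comm, ← neg_mul, this]
    ring
  have h2 : NormedSpace.exp (-t) = Complex.cos ((θ / 2 : ℝ) : ℂ)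
      + Complex.sin ((θ / 2 : ℝ) : ℂ) * Complex.I := by
    rw [← Complex.exp_eq_exp_ℂ, ht, neg_neg, mul_comm, Complex.exp_mul_I]
  rw [signalRot, h, Matrix.exp_conj _ _ (IsUnit.of_mul_eq_one _ hVW), Matrix.exp_diagonal, hinv,
    exp_pair, diagonal_pair, h1, h2, Complex.ofReal_cos, Complex.ofReal_sin]
  have hI := Complex.I_mul_I
  ext i j
  fin_cases i <;> fin_cases j <;>
    simp [hV, hW, -Complex.ofReal_div]
  · ring
  · linear_combination (Complex.sin ((θ / 2 : ℝ) : ℂ)) * hI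
  · linear_combination (-Complex.sin ((θ / 2 : ℝ) : ℂ)) * hI
  · linear_combination (-Complex.cos ((θ / 2 : ℝ) : ℂ)) * hI

/-- The product of the single-qubit echoes with the phase pairs in `L`. -/
noncomputable def qubitWord (θ : ℝ) (L : List (ℝ × ℝ)) : Matrix (Fin 2) (Fin 2) ℂ :=
  (L.map fun x => (signalRot θ)ᴴ * qubitRot x.1 * signalRot θ * qubitRot x.2).prod

/-- Every normalized pair of polynomials is the first row of a phase sequence. -/
theorem exists_phases (d : ℕ) : ∀ P H : ℂ[X], P.natDegree ≤ d → H.degree < d →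
    P * conjPoly P + X * (1 - X) * (H * conjPoly H) = 1 →
    ∃ (χ : ℝ) (L : List (ℝ × ℝ)), L.length = d ∧ ∀ θ : ℝ,
      (qubitRot χ * qubitWord θ L) 0 0 = P.eval (((Real.cos (θ / 2) : ℝ) : ℂ) ^ 2) ∧
      (qubitRot χ * qubitWord θ L) 0 1 = ((Real.sin (θ / 2) : ℝ) : ℂ) *
        ((Real.cos (θ / 2) : ℝ) : ℂ) * H.eval (((Real.cos (θ / 2) : ℝ) : ℂ) ^ 2) := by
  induction d with
  | zero =>
    intro P H hP hH hn
    have hH0 : H = 0 := by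
      rw [← degree_eq_bot]
      exact Nat.WithBot.lt_zero_iff.1 hH
    obtain ⟨z, rfl⟩ := natDegree_eq_zero.1 (Nat.le_zero.1 hP)
    have hz : ‖z‖ = 1 := by
      rw [hH0, conjPoly_C, zero_mul, mul_zero, add_zero, ← C_mul, ← C_1, C_inj, Complex.mul_conj,
        Complex.normSq_eq_norm_sq] at hn
      have : ‖z‖ ^ 2 = 1 := by exact_mod_cast hn
      exact (pow_eq_one_iff_of_nonneg (norm_nonneg z) two_ne_zero).1 this
    obtain ⟨χ, hχ⟩ := exists_phase_eq hz
    refine ⟨χ, [], rfl, fun θ => ?_⟩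
    simp [qubitWord, qubitRot_eq, hχ, hH0]
  | succ d ih =>
    intro P H hP hH hn
    have hHd : H.natDegree ≤ d := by
      by_cases h0 : H = 0
      · simp [h0]
      · exact Nat.lt_succ_iff.1 ((natDegree_lt_iff_degree_lt h0).2 hH)
    -- Layers are removed from the right: this strips the signal rotation and the phase `φ`, leaving
    -- the row `(c p, s q)`; the next step strips the adjoint rotation and `φ'`.
    obtain ⟨φ, p, q, hp, hq, hpq, eP, eH⟩ := exists_odd_of_even hP hHd hn
    obtain ⟨φ', P', H', hP', hH', hn', ep, eq⟩ := exists_even_of_odd hp hq hpq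
    obtain ⟨χ, L, hL, hrow⟩ := ih P' H' hP' hH' hn'
    refine ⟨χ, L ++ [(φ', φ)], by simp [hL], fun θ => ?_⟩
    obtain ⟨h0, h1⟩ := hrow θ
    have hw : qubitRot χ * qubitWord θ (L ++ [(φ', φ)]) = (qubitRot χ * qubitWord θ L) *
        ((signalRot θ)ᴴ * qubitRot φ' * signalRot θ * qubitRot φ) := by
      simp [qubitWord, Matrix.mul_assoc]
    have hcs : ((Real.sin (θ / 2) : ℝ) : ℂ) ^ 2 = 1 - ((Real.cos (θ / 2) : ℝ) : ℂ) ^ 2 := by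
      have := Real.sin_sq (θ / 2)
      exact_mod_cast this
    rw [hw, signalRot_eq, qubitRot_eq φ, qubitRot_eq φ']
    generalize qubitRot χ * qubitWord θ L = M at *
    rw [eP, eH, ep, eq]
    generalize Real.cos (θ / 2) = c at *
    generalize Real.sin (θ / 2) = s at *
    have hadj : (!![(c : ℂ), -(s : ℂ); (s : ℂ), (c : ℂ)])ᴴ =
        !![(c : ℂ), (s : ℂ); -(s : ℂ), (c : ℂ)] := by
      ext i j
      fin_cases i <;> fin_cases j <;> simp
    rw [Matrix.eta_fin_two M, h0, h1, hadj]
    simp only [Matrix.mul_fin_two, Matrix.of_apply, Matrix.cons_val', Matrix.cons_val_zero,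
      Matrix.cons_val_one, Matrix.cons_val_fin_one, eval_mul, eval_add, eval_sub, eval_C, eval_X,
      eval_one]
    constructor
    · linear_combination (phase φ * (-(c : ℂ) ^ 2 * phase φ' * H'.eval ((c : ℂ) ^ 2)
        + phase (-φ') * (P'.eval ((c : ℂ) ^ 2) + (c : ℂ) ^ 2 * H'.eval ((c : ℂ) ^ 2)))) * hcs
    · linear_combination (phase (-φ) * (s * c * phase φ' * H'.eval ((c : ℂ) ^ 2))) * hcs

/-! ### Alternating words in two projections. -/

/-- The rotation with eigenvalue `e^{-iφ}` on the range of the projection `E` and `e^{iφ}` on its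
kernel. -/
noncomputable def projRot {A : Type*} [Ring A] [Algebra ℂ A] (E : A) (φ : ℝ) : A :=
  phase (-φ) • 1 + (phase φ - phase (-φ)) • E

/-- The alternating word in the rotations about `F` and `E`. -/
noncomputable def projWord {A : Type*} [Ring A] [Algebra ℂ A] (E F : A) (L : List (ℝ × ℝ)) : A :=
  (L.map fun x => projRot F x.1 * projRot E x.2).prod

/-- The polynomials `p, q` with
`projWord E F L * E = p(T) E + F q(T) E`, where `T = E F E`. -/
noncomputable def wordPolys : List (ℝ × ℝ) → ℂ[X] × ℂ[X]
  | [] => (1, 0)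
  | x :: L =>
    let p := C (phase x.2) * (wordPolys L).1 +
      C (phase x.2 - phase (-x.2)) * (X * (wordPolys L).2)
    let q := C (phase (-x.2)) * (wordPolys L).2
    (C (phase (-x.1)) * p, C (phase x.1) * q + C (phase x.1 - phase (-x.1)) * p)

/-- Bounding `X * q` rather than `q` avoids subtraction on lengths and is the form that enters the
compression. -/
theorem natDegree_wordPolys (L : List (ℝ × ℝ)) :
    (wordPolys L).1.natDegree ≤ L.length ∧ (X * (wordPolys L).2).natDegree ≤ L.length := by
  induction L with
  | nil => simp [wordPolys]
  | cons x L ih =>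
    obtain ⟨h1, h2⟩ := ih
    have hp : (C (phase x.2) * (wordPolys L).1 +
        C (phase x.2 - phase (-x.2)) * (X * (wordPolys L).2)).natDegree ≤ L.length :=
      natDegree_add_le_of_degree_le ((natDegree_C_mul_le _ _).trans h1)
        ((natDegree_C_mul_le _ _).trans h2)
    simp only [wordPolys, List.length_cons]
    constructor
    · exact ((natDegree_C_mul_le _ _).trans hp).trans (Nat.le_succ _)
    · rw [mul_add, mul_left_comm X, mul_left_comm X, mul_left_comm X]
      refine natDegree_add_le_of_degree_le ?_ ?_
      · exact (natDegree_C_mul_le _ _).trans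
          ((natDegree_C_mul_le _ _).trans (h2.trans (Nat.le_succ _)))
      · refine (natDegree_C_mul_le _ _).trans ?_
        rw [add_comm L.length]
        exact natDegree_mul_le_of_le natDegree_X_le hp

section Algebra

variable {A : Type*} [Ring A] [Algebra ℂ A] {E F : A}

theorem commute_aeval {S T : A} (h : Commute S T) (f : ℂ[X]) : Commute S (aeval T f) := by
  induction f using Polynomial.induction_on' with
  | add p q hp hq => rw [map_add]; exact hp.add_right hq
  | monomial n c =>
    rw [aeval_monomial]
    exact (Algebra.commute_algebraMap_right c S).mul_right (h.pow_right n)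

theorem mul_aeval_mul (hE : E * E = E) (f : ℂ[X]) :
    E * (aeval (E * F * E) f * E) = aeval (E * F * E) f * E := by
  have hc : Commute E (E * F * E) := by
    rw [Commute, SemiconjBy, ← mul_assoc, ← mul_assoc, hE, mul_assoc (E * F), hE]
  rw [← mul_assoc, (commute_aeval hc f).eq, mul_assoc, hE]

/-- Since `f(T) E` absorbs an `E` on its left, `E F` acts on it as `T`. -/
theorem mul_mul_aeval_mul (hE : E * E = E) (f : ℂ[X]) :
    E * (F * (aeval (E * F * E) f * E)) = aeval (E * F * E) (X * f) * E := by
  conv_lhs => rw [← mul_aeval_mul hE]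
  simp only [map_mul, aeval_X, mul_assoc]

/-- Expressions `p(T) E + F q(T) E` are closed under left multiplication by `E` and `F`; `wordPolys`
records the resulting recursion. -/
theorem projWord_mul (hE : E * E = E) (hF : F * F = F) (L : List (ℝ × ℝ)) :
    projWord E F L * E = aeval (E * F * E) (wordPolys L).1 * E +
      F * (aeval (E * F * E) (wordPolys L).2 * E) := by
  have hF' : ∀ a, F * (F * a) = F * a := fun a => by rw [← mul_assoc, hF]
  induction L with
  | nil => simp [projWord, wordPolys]
  | cons x L ih =>
    have hw : projWord E F (x :: L) * E
        = projRot F x.1 * (projRot E x.2 * (projWord E F L * E)) := by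
      simp [projWord, mul_assoc]
    rw [hw, ih]
    simp only [wordPolys, projRot, add_mul, mul_add, smul_mul_assoc, one_mul, mul_smul_comm,
      mul_aeval_mul hE, mul_mul_aeval_mul hE, hF', ← smul_eq_C_mul, map_add, map_smul]
    module

/-- The compression of an alternating word by `E` is a polynomial in `E F E`. -/
theorem mul_projWord_mul (hE : E * E = E) (hF : F * F = F) (L : List (ℝ × ℝ)) :
    E * projWord E F L * E =
      aeval (E * F * E) ((wordPolys L).1 + X * (wordPolys L).2) * E := by
  rw [mul_assoc, projWord_mul hE hF, mul_add, mul_aeval_mul hE, mul_mul_aeval_mul hE, map_add,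
    add_mul]

end Algebra

theorem aeval_mulVec {n : Type*} [Fintype n] [DecidableEq n] {T : Matrix n n ℂ} {v : n → ℂ} {μ : ℂ}
    (h : T *ᵥ v = μ • v) (f : ℂ[X]) : aeval T f *ᵥ v = f.eval μ • v := by
  induction f using Polynomial.induction_on' with
  | add p q hp hq => rw [map_add, Matrix.add_mulVec, hp, hq, eval_add, add_smul]
  | monomial k c =>
    rw [aeval_monomial, eval_monomial, Matrix.algebraMap_eq_diagonal]
    have hk : T ^ k *ᵥ v = μ ^ k • v := by
      induction k with
      | zero => simp
      | succ k ih =>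
        rw [pow_succ, ← Matrix.mulVec_mulVec, h, Matrix.mulVec_smul, ih, smul_smul, pow_succ,
          mul_comm]
    rw [← Matrix.mulVec_mulVec, hk, Matrix.mulVec_smul, mul_smul, smul_comm]
    congr 1
    ext i
    simp [Matrix.mulVec_diagonal]

/-! ### The QSP polynomial of a phase sequence and its vacuum amplitude. -/

/-- The phase pairs of the echoes, from left to right. -/
def phasePairs (d : ℕ) (φ : Fin (2 * d + 1) → ℝ) : List (ℝ × ℝ) :=
  List.ofFn fun r : Fin d => (φ ⟨2 * r + 1, by omega⟩, φ ⟨2 * r, by omega⟩)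

@[simp] theorem length_phasePairs (d : ℕ) (φ : Fin (2 * d + 1) → ℝ) :
    (phasePairs d φ).length = d := by simp [phasePairs]

theorem exists_phasePairs_eq (χ : ℝ) (L : List (ℝ × ℝ)) :
    ∃ φ : Fin (2 * L.length + 1) → ℝ, φ (Fin.last _) = χ ∧ phasePairs L.length φ = L := by
  -- Index `k` belongs to layer `k / 2`, with odd `k` the first component; only the last index falls
  -- outside the list and receives `χ`.
  refine ⟨fun k => if h : (k : ℕ) / 2 < L.length then
    if (k : ℕ) % 2 = 1 then (L[(k : ℕ) / 2]).1 else (L[(k : ℕ) / 2]).2 else χ, ?_, ?_⟩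
  · simp
  · apply List.ext_getElem
    · simp
    · intro r h1 h2
      have e1 : (2 * r + 1) / 2 = r := by omega
      simp [phasePairs, e1, h2]

/-- The QSP polynomial of a phase sequence, in the variable `y = x²`. -/
noncomputable def halfPoly (d : ℕ) (φ : Fin (2 * d + 1) → ℝ) : ℂ[X] :=
  C (phase (φ (Fin.last (2 * d)))) *
    ((wordPolys (phasePairs d φ)).1 + X * (wordPolys (phasePairs d φ)).2)

theorem natDegree_halfPoly (d : ℕ) (φ : Fin (2 * d + 1) → ℝ) : (halfPoly d φ).natDegree ≤ d := by
  have h := natDegree_wordPolys (phasePairs d φ)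
  rw [length_phasePairs] at h
  exact (natDegree_C_mul_le _ _).trans (natDegree_add_le_of_degree_le h.1 h.2)

/-- The QSP polynomial of a phase sequence. -/
noncomputable def qspPoly (d : ℕ) (φ : Fin (2 * d + 1) → ℝ) : ℂ[X] := expand ℂ 2 (halfPoly d φ)

theorem eval_qspPoly (d : ℕ) (φ : Fin (2 * d + 1) → ℝ) (x : ℂ) :
    (qspPoly d φ).eval x = (halfPoly d φ).eval (x ^ 2) := expand_eval _ _ _

theorem natDegree_qspPoly (d : ℕ) (φ : Fin (2 * d + 1) → ℝ) :
    (qspPoly d φ).natDegree ≤ 2 * d := by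
  rw [qspPoly, natDegree_expand, mul_comm]
  exact Nat.mul_le_mul_left 2 (natDegree_halfPoly d φ)

theorem qspPoly_comp_neg_X (d : ℕ) (φ : Fin (2 * d + 1) → ℝ) :
    (qspPoly d φ).comp (-X) = qspPoly d φ := by
  rw [qspPoly, expand_eq_comp_X_pow, comp_assoc]
  simp

theorem aeval_halfPoly_mul {A : Type*} [Ring A] [Algebra ℂ A] {E F : A} (hE : E * E = E)
    (hF : F * F = F) (d : ℕ) (φ : Fin (2 * d + 1) → ℝ) :
    phase (φ (Fin.last (2 * d))) • (E * projWord E F (phasePairs d φ) * E) =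
      aeval (E * F * E) (halfPoly d φ) * E := by
  rw [mul_projWord_mul hE hF, halfPoly, ← smul_eq_C_mul, map_smul, smul_mul_assoc]

/-- The vacuum amplitude of an alternating word, for an eigenvector decomposition of the vacuum. -/
theorem vacuum_amplitude {n : Type*} [Fintype n] [DecidableEq n] {B E F : Matrix n n ℂ} {e : n → ℂ}
    (hE : E * E = E) (hF : F * F = F) (he : E *ᵥ e = e) (he' : e ᵥ* E = e) {ι : Type*} [Fintype ι]
    {u : ι → n → ℂ} {μ a : ι → ℂ} (hu : ∀ l, (E * F * E) *ᵥ u l = μ l • u l)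
    (ha : e = ∑ l, a l • u l) (d : ℕ) (φ : Fin (2 * d + 1) → ℝ)
    (hB : e ᵥ* B = phase (φ (Fin.last (2 * d))) • e) :
    e ⬝ᵥ ((B * projWord E F (phasePairs d φ)) *ᵥ e) =
      ∑ l, a l * (e ⬝ᵥ u l) * (halfPoly d φ).eval (μ l) := by
  set W := projWord E F (phasePairs d φ) with hW
  have h1 : e ⬝ᵥ ((B * W) *ᵥ e) = e ⬝ᵥ (aeval (E * F * E) (halfPoly d φ) *ᵥ e) := by
    have h2 := aeval_halfPoly_mul hE hF d φ
    calc e ⬝ᵥ ((B * W) *ᵥ e) = phase (φ (Fin.last (2 * d))) • (e ⬝ᵥ (W *ᵥ e)) := by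
          rw [← Matrix.mulVec_mulVec, Matrix.dotProduct_mulVec, hB, smul_dotProduct]
      _ = phase (φ (Fin.last (2 * d))) • (e ⬝ᵥ ((E * W * E) *ᵥ e)) := by
          rw [← Matrix.mulVec_mulVec, ← Matrix.mulVec_mulVec, he, Matrix.dotProduct_mulVec e E, he']
      _ = e ⬝ᵥ ((aeval (E * F * E) (halfPoly d φ) * E) *ᵥ e) := by
          rw [← h2, Matrix.smul_mulVec, dotProduct_smul]
      _ = _ := by rw [← Matrix.mulVec_mulVec, he]
  rw [h1]
  nth_rw 2 [ha]
  rw [Matrix.mulVec_sum, dotProduct_sum]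
  refine Finset.sum_congr rfl fun l _ => ?_
  rw [Matrix.mulVec_smul, aeval_mulVec (hu l), dotProduct_smul, dotProduct_smul, smul_eq_mul,
    smul_eq_mul]
  ring

section Unitary

variable {n : Type*} [Fintype n] [DecidableEq n] {U E : Matrix n n ℂ}

/-- A rotation is affine in its projection, so conjugation by `U` moves onto the projection. -/
theorem conj_projRot (hU : Uᴴ * U = 1) (φ : ℝ) :
    Uᴴ * projRot E φ * U = projRot (Uᴴ * E * U) φ := by
  simp only [projRot, mul_add, add_mul, Matrix.mul_smul, Matrix.smul_mul, mul_one, hU]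

theorem conj_mul_self (hU : U * Uᴴ = 1) (hE : E * E = E) :
    (Uᴴ * E * U) * (Uᴴ * E * U) = Uᴴ * E * U := by
  calc _ = Uᴴ * E * (U * Uᴴ) * E * U := by simp only [Matrix.mul_assoc]
    _ = Uᴴ * (E * E) * U := by rw [hU]; simp only [Matrix.mul_assoc, Matrix.one_mul]
    _ = _ := by rw [hE]

theorem apply_eq_dotProduct_mulVec (M : Matrix n n ℂ) (k : n) :
    M k k = Pi.single k 1 ⬝ᵥ (M *ᵥ Pi.single k 1) := by
  simp

end Unitary

/-! ### The single qubit -/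

theorem qubitRot_eq_projRot (φ : ℝ) : qubitRot φ = projRot !![1, 0; 0, 0] φ := by
  rw [qubitRot_eq, projRot]
  ext i j
  fin_cases i <;> fin_cases j <;> simp

theorem signalRot_adj_eq (θ : ℝ) : (signalRot θ)ᴴ =
    !![((Real.cos (θ / 2) : ℝ) : ℂ), ((Real.sin (θ / 2) : ℝ) : ℂ);
      -((Real.sin (θ / 2) : ℝ) : ℂ), ((Real.cos (θ / 2) : ℝ) : ℂ)] := by
  rw [signalRot_eq]
  ext i j
  fin_cases i <;> fin_cases j <;> simp [-Complex.ofReal_cos, -Complex.ofReal_sin]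

theorem signalRot_adj_mul (θ : ℝ) : (signalRot θ)ᴴ * signalRot θ = 1 := by
  rw [signalRot_adj_eq, signalRot_eq, Matrix.mul_fin_two, Matrix.one_fin_two]
  have h : ((Real.cos (θ / 2) : ℝ) : ℂ) * (Real.cos (θ / 2) : ℝ) +
      (Real.sin (θ / 2) : ℝ) * (Real.sin (θ / 2) : ℝ) = 1 := by
    have := Real.cos_sq_add_sin_sq (θ / 2)
    rw [sq, sq] at this
    exact_mod_cast this
  congr 1
  ext i j
  fin_cases i <;> fin_cases j <;> simp [-Complex.ofReal_cos, -Complex.ofReal_sin]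
  · exact h
  · ring
  · ring
  · rw [add_comm]; exact h

theorem qubitRot_adj_mul (φ : ℝ) : (qubitRot φ)ᴴ * qubitRot φ = 1 := by
  have h := phase_mul_phase_neg φ
  rw [qubitRot_eq]
  ext i j
  fin_cases i <;> fin_cases j <;>
    simp [Matrix.mul_apply, Fin.sum_univ_two, Matrix.conjTranspose_apply, conj_phase, h, mul_comm]

theorem qspAmplitude_eq_qubitWord (d : ℕ) (φ : Fin (2 * d + 1) → ℝ) (θ : ℝ) :
    qspAmplitude d φ θ =
      (qubitRot (φ (Fin.last (2 * d))) * qubitWord θ (phasePairs d φ)) 0 0 := by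
  rw [qspAmplitude, qubitWord, phasePairs, List.map_ofFn]
  rfl

theorem qubitWord_eq_projWord (θ : ℝ) (L : List (ℝ × ℝ)) :
    qubitWord θ L =
      projWord !![1, 0; 0, 0] ((signalRot θ)ᴴ * !![1, 0; 0, 0] * signalRot θ) L := by
  rw [qubitWord, projWord]
  congr 1
  refine List.map_congr_left fun x _ => ?_
  rw [qubitRot_eq_projRot, conj_projRot (signalRot_adj_mul θ), qubitRot_eq_projRot]

/-- Here `E` has rank one, so `|0⟩` alone is an eigenvector decomposition of the vacuum, with
eigenvalue `cos²`. -/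
theorem qspAmplitude_eq (d : ℕ) (φ : Fin (2 * d + 1) → ℝ) (θ : ℝ) :
    qspAmplitude d φ θ = (halfPoly d φ).eval (((Real.cos (θ / 2) : ℝ) : ℂ) ^ 2) := by
  have hE : (!![1, 0; 0, 0] : Matrix (Fin 2) (Fin 2) ℂ) * !![1, 0; 0, 0] = !![1, 0; 0, 0] := by
    rw [Matrix.mul_fin_two]
    simp
  have hF := conj_mul_self (mul_eq_one_comm.1 (signalRot_adj_mul θ)) hE
  rw [qspAmplitude_eq_qubitWord, apply_eq_dotProduct_mulVec (_ * _), qubitWord_eq_projWord,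
    vacuum_amplitude hE hF (ι := Unit) (u := fun _ => Pi.single 0 1)
      (μ := fun _ => ((Real.cos (θ / 2) : ℝ) : ℂ) ^ 2) (a := fun _ => 1)]
  · simp
  · ext i
    fin_cases i <;> simp
  · ext i
    fin_cases i <;> simp
  · intro _
    rw [signalRot_adj_eq, signalRot_eq]
    ext i
    fin_cases i <;> simp [-Complex.ofReal_cos, -Complex.ofReal_sin, sq]
  · simp
  · rw [qubitRot_eq]
    ext i
    fin_cases i <;> simp

theorem norm_qspAmplitude_le (d : ℕ) (φ : Fin (2 * d + 1) → ℝ) (θ : ℝ) :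
    ‖qspAmplitude d φ θ‖ ≤ 1 := by
  have hR : signalRot θ ∈ Matrix.unitaryGroup (Fin 2) ℂ :=
    Matrix.mem_unitaryGroup_iff'.2 (signalRot_adj_mul θ)
  have hQ : ∀ φ, qubitRot φ ∈ Matrix.unitaryGroup (Fin 2) ℂ := fun φ =>
    Matrix.mem_unitaryGroup_iff'.2 (qubitRot_adj_mul φ)
  rw [qspAmplitude_eq_qubitWord]
  refine entry_norm_bound_of_unitary (mul_mem (hQ _) (list_prod_mem fun M hM => ?_)) 0 0
  obtain ⟨x, -, rfl⟩ := List.mem_map.1 hM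
  exact mul_mem (mul_mem (mul_mem (Unitary.star_mem hR) (hQ _)) hR) (hQ _)

/-- The values of `cos²` fill `[0, 1]`, which is infinite. -/
theorem eq_of_eval_cos_sq_eq {f g : ℂ[X]}
    (h : ∀ θ : ℝ, f.eval (((Real.cos (θ / 2) : ℝ) : ℂ) ^ 2) =
      g.eval (((Real.cos (θ / 2) : ℝ) : ℂ) ^ 2)) : f = g := by
  refine eq_of_infinite_eval_eq f g (Set.Infinite.mono (s := (fun y : ℝ => (y : ℂ)) '' Set.Icc 0 1)
    ?_ ((Set.Icc_infinite one_pos).image Complex.ofReal_injective.injOn))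
  rintro _ ⟨y, hy, rfl⟩
  have := h (2 * Real.arccos √y)
  rw [mul_div_cancel_left₀ _ two_ne_zero, Real.cos_arccos (by linarith [Real.sqrt_nonneg y])
    (Real.sqrt_le_one.2 hy.2), ← Complex.ofReal_pow, Real.sq_sqrt hy.1] at this
  exact this

/-- The synthesized sequence has amplitude `P(cos²)`, and also `halfPoly` at `cos²`, so the two
polynomials coincide. -/
theorem exists_halfPoly_eq {d : ℕ} {P H : ℂ[X]} (hP : P.natDegree ≤ d) (hH : H.degree < d)
    (hn : P * conjPoly P + X * (1 - X) * (H * conjPoly H) = 1) :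
    ∃ φ : Fin (2 * d + 1) → ℝ, halfPoly d φ = P := by
  obtain ⟨χ, L, rfl, h⟩ := exists_phases d P H hP hH hn
  obtain ⟨φ, hχ, hL⟩ := exists_phasePairs_eq χ L
  refine ⟨φ, eq_of_eval_cos_sq_eq fun θ => ?_⟩
  rw [← qspAmplitude_eq, qspAmplitude_eq_qubitWord, hχ, hL, (h θ).1]

/-! ### Target polynomials -/

theorem exists_expand_eq_of_even {p : ℝ[X]} {d : ℕ} (hd : p.natDegree ≤ 2 * d)
    (he : p.comp (-X) = p) : ∃ g : ℝ[X], expand ℝ 2 g = p ∧ g.natDegree ≤ d := by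
  have h : expand ℝ 2 (contract 2 p) = p := by
    ext n
    rw [coeff_expand two_pos, coeff_contract two_ne_zero]
    split_ifs with hn
    · rw [Nat.div_mul_cancel hn]
    · have h1 := congrArg (fun f => coeff f n) he
      have h2 : (-X : ℝ[X]) = C (-1) * X := by simp
      rw [h2, comp_C_mul_X_coeff, (Nat.not_even_iff_odd.1 (fun h => hn h.two_dvd)).neg_one_pow] at h1
      linarith
  refine ⟨contract 2 p, h, ?_⟩
  have := natDegree_expand 2 (contract 2 p)
  rw [h] at this
  omega

theorem conjPoly_map_ofReal (f : ℝ[X]) :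
    conjPoly (f.map (algebraMap ℝ ℂ)) = f.map (algebraMap ℝ ℂ) := by
  ext n
  simp [conjPoly]

theorem eval_map_ofReal (f : ℝ[X]) (x : ℝ) :
    (f.map (algebraMap ℝ ℂ)).eval (x : ℂ) = ((f.eval x : ℝ) : ℂ) := by
  rw [← Complex.coe_algebraMap, eval_map_algebraMap, aeval_algebraMap_apply]
  simp

/-- The real part of a QSP polynomial can be any bounded even real polynomial. -/
theorem exists_re_qspPoly_eq {d : ℕ} {p : ℝ[X]} (hd : p.natDegree ≤ 2 * d)
    (he : p.comp (-X) = p) (hb : ∀ x : ℝ, |x| ≤ 1 → |p.eval x| ≤ 1) :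
    ∃ φ : Fin (2 * d + 1) → ℝ, ∀ x : ℝ, ((qspPoly d φ).eval (x : ℂ)).re = p.eval x := by
  obtain ⟨g, rfl, hg⟩ := exists_expand_eq_of_even hd he
  have hf : ∀ y ∈ Set.Icc (0 : ℝ) 1, 0 ≤ (1 - g ^ 2).eval y := by
    intro y hy
    have h1 := hb √y (by rw [abs_of_nonneg (Real.sqrt_nonneg y)]; exact Real.sqrt_le_one.2 hy.2)
    rw [expand_eval, Real.sq_sqrt hy.1] at h1
    have := (sq_le_one_iff_abs_le_one _).2 h1
    simpa using this
  have hfd : (1 - g ^ 2).natDegree ≤ 2 * d := by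
    refine (natDegree_sub_le _ _).trans (max_le (by simp) (natDegree_pow_le.trans ?_))
    omega
  obtain ⟨b, h, hbd, hh, hbh⟩ := exists_lukacs d _ hfd hf
  -- As `g` and `b` are real, `P = g + i b` satisfies `P * conjPoly P = g² + b²`, so the Lukács
  -- identity is the required normalization.
  obtain ⟨φ, hφ⟩ := exists_halfPoly_eq (d := d)
    (P := g.map (algebraMap ℝ ℂ) + C Complex.I * b.map (algebraMap ℝ ℂ))
    (H := h.map (algebraMap ℝ ℂ))
    (natDegree_add_le_of_degree_le (natDegree_map_le.trans hg)
      ((natDegree_C_mul_le _ _).trans (natDegree_map_le.trans hbd)))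
    (degree_map_le.trans_lt hh) (by
      have h1 := congrArg (Polynomial.map (algebraMap ℝ ℂ)) hbh
      simp only [Polynomial.map_sub, Polynomial.map_one, Polynomial.map_pow, Polynomial.map_add,
        Polynomial.map_mul, map_X] at h1
      have hI : (C Complex.I * C Complex.I : ℂ[X]) = -1 := by
        rw [← C_mul, Complex.I_mul_I, C_neg, C_1]
      simp only [map_add, map_mul, conjPoly_map_ofReal, conjPoly_C, Complex.conj_I, C_neg]
      linear_combination -h1 - (b.map (algebraMap ℝ ℂ)) ^ 2 * hI)
  refine ⟨φ, fun x => ?_⟩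
  rw [eval_qspPoly, hφ, expand_eval, ← Complex.ofReal_pow, eval_add, eval_mul, eval_C,
    eval_map_ofReal, eval_map_ofReal]
  simp

/-- Under the growth conditions off `[-1, 1]` the polynomial itself is a QSP polynomial. -/
theorem exists_qspPoly_eq {d : ℕ} {p : ℝ[X]} (hd : p.natDegree ≤ 2 * d)
    (he : p.comp (-X) = p) (hb : ∀ x : ℝ, |x| ≤ 1 → |p.eval x| ≤ 1)
    (hr : ∀ x : ℝ, 1 ≤ |x| → 1 ≤ |p.eval x|)
    (hi : ∀ x : ℝ, 1 ≤ ‖aeval (Complex.I * (x : ℂ)) p‖) :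
    ∃ φ : Fin (2 * d + 1) → ℝ, qspPoly d φ = p.map (algebraMap ℝ ℂ) := by
  obtain ⟨g, rfl, hg⟩ := exists_expand_eq_of_even hd he
  have hin : ∀ y ∈ Set.Icc (0 : ℝ) 1, 0 ≤ (1 - g ^ 2).eval y := by
    intro y hy
    have h1 := hb √y (by rw [abs_of_nonneg (Real.sqrt_nonneg y)]; exact Real.sqrt_le_one.2 hy.2)
    rw [expand_eval, Real.sq_sqrt hy.1] at h1
    have := (sq_le_one_iff_abs_le_one _).2 h1
    simpa using this
  have hgt : ∀ y, 1 ≤ y → (1 - g ^ 2).eval y ≤ 0 := by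
    intro y hy
    have h1 := hr √y (by rw [abs_of_nonneg (Real.sqrt_nonneg y)]; exact Real.one_le_sqrt.2 hy)
    rw [expand_eval, Real.sq_sqrt (by linarith)] at h1
    have := (one_le_sq_iff_one_le_abs _).2 h1
    simpa using this
  -- Negative `y` are the squares of imaginary signals, which is where the condition on the
  -- imaginary axis enters.
  have hlt : ∀ y, y ≤ 0 → (1 - g ^ 2).eval y ≤ 0 := by
    intro y hy
    have h1 := hi √(-y)
    have hsq : (Complex.I * ((√(-y) : ℝ) : ℂ)) ^ 2 = (y : ℂ) := by
      rw [mul_pow, Complex.I_sq, ← Complex.ofReal_pow, Real.sq_sqrt (by linarith)]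
      simp
    rw [expand_aeval, hsq, ← eval_map_algebraMap, eval_map_ofReal, Complex.norm_real,
      Real.norm_eq_abs] at h1
    have := (one_le_sq_iff_one_le_abs _).2 h1
    simpa using this
  -- The inequalities on both sides meet at `0` and `1`; the sign changes of `1 - g²` match those of
  -- `y (1 - y)`, so the quotient is nonnegative everywhere.
  have h0 : (1 - g ^ 2).eval 0 = 0 := le_antisymm (hlt 0 le_rfl) (hin 0 (by simp))
  have h1 : (1 - g ^ 2).eval 1 = 0 := le_antisymm (hgt 1 le_rfl) (hin 1 (by simp))
  obtain ⟨k, hk⟩ := dvd_iff_isRoot.2 h0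
  have hk1 : k.eval 1 = 0 := by
    rw [hk] at h1
    simpa using h1
  obtain ⟨m, hm⟩ := dvd_iff_isRoot.2 hk1
  obtain ⟨c, rfl⟩ : ∃ c, m = -c := ⟨-m, by simp⟩
  have hc : 1 - g ^ 2 = X * (1 - X) * c := by
    rw [hk, hm, C_0, C_1]
    ring
  have hcpos : ∀ y, 0 ≤ c.eval y := by
    intro y
    have hden : Dense (({0}ᶜ : Set ℝ) ∩ {1}ᶜ) :=
      (dense_compl_singleton (0 : ℝ)).inter_of_isOpen_left (dense_compl_singleton 1)
        isOpen_compl_singleton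
    refine eval_nonneg_of_mem_closure (fun y hy => ?_) (hden y)
    have hy0 : y ≠ 0 := hy.1
    have hy1 : y ≠ 1 := hy.2
    have hev : (1 - g ^ 2).eval y = y * (1 - y) * c.eval y := by
      rw [hc]
      simp
    rcases lt_or_gt_of_ne hy0 with h | h
    · have h2 := hlt y h.le
      rw [hev] at h2
      by_contra! hneg
      exact absurd h2 (not_le.2 (mul_pos_of_neg_of_neg
        (mul_neg_of_neg_of_pos h (by linarith)) hneg))
    rcases lt_or_gt_of_ne hy1 with h' | h'
    · have h2 := hin y ⟨h.le, h'.le⟩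
      rw [hev] at h2
      exact nonneg_of_mul_nonneg_right h2 (mul_pos h (by linarith))
    · have h2 := hgt y h'.le
      rw [hev] at h2
      by_contra! hneg
      exact absurd h2 (not_le.2 (mul_pos_of_neg_of_neg
        (mul_neg_of_pos_of_neg h (by linarith)) hneg))
  obtain ⟨h, hh⟩ := exists_mul_conj_of_nonneg _ c le_rfl hcpos
  have hhd : h.degree < d := by
    by_cases hz : h = 0
    · simp [hz, bot_lt_iff_ne_bot]
    have hz' : h.map (starRingEnd ℂ) ≠ 0 :=
      (Polynomial.map_ne_zero_iff (starRingEnd ℂ).injective).2 hz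
    have hcd : c.natDegree = h.natDegree + h.natDegree := by
      rw [← natDegree_map (algebraMap ℝ ℂ), hh, natDegree_mul hz hz',
        natDegree_map]
    have hc0 : c ≠ 0 := by
      rintro rfl
      rw [Polynomial.map_zero] at hh
      exact (mul_ne_zero hz hz') hh.symm
    have hfd : (1 - g ^ 2).natDegree ≤ 2 * d := by
      refine (natDegree_sub_le _ _).trans (max_le (by simp) (natDegree_pow_le.trans ?_))
      omega
    have hX : (X * (1 - X) : ℝ[X]).natDegree = 2 := by
      have : (X * (1 - X) : ℝ[X]) = X - X ^ 2 := by ring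
      rw [this]
      compute_degree!
    rw [hc, natDegree_mul (by intro h0; simp [h0] at hX) hc0, hX, hcd] at hfd
    rw [← natDegree_lt_iff_degree_lt hz]
    omega
  obtain ⟨φ, hφ⟩ := exists_halfPoly_eq (d := d) (P := g.map (algebraMap ℝ ℂ)) (H := h)
    (natDegree_map_le.trans hg) hhd (by
      have h1 := congrArg (Polynomial.map (algebraMap ℝ ℂ)) hc
      simp only [Polynomial.map_sub, Polynomial.map_one, Polynomial.map_pow,
        Polynomial.map_mul, map_X, hh] at h1
      rw [conjPoly_map_ofReal]
      have e : conjPoly h = h.map (starRingEnd ℂ) := rfl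
      rw [e]
      linear_combination -h1)
  exact ⟨φ, by rw [qspPoly, hφ, map_expand]⟩

/-! ### Singular value decompositions -/

/-- Right singular vectors are eigenvectors of `A† A`. Their images, normalized where the singular
value is nonzero, are orthonormal and extend to a basis because the dimensions agree; the remaining
images vanish. -/
theorem exists_isSVD {E F : Type*} [NormedAddCommGroup E] [InnerProductSpace ℂ E]
    [FiniteDimensional ℂ E] [NormedAddCommGroup F] [InnerProductSpace ℂ F] [FiniteDimensional ℂ F]
    {n : ℕ} (hE : Module.finrank ℂ E = n) (hF : Module.finrank ℂ F = n) (A : E →ₗ[ℂ] F) :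
    ∃ (w : OrthonormalBasis (Fin n) ℂ F) (v : OrthonormalBasis (Fin n) ℂ E),
      IsSVD A (fun l : Fin n => A.singularValues (l : ℕ)) w v := by
  set v := A.isSymmetric_adjoint_comp_self.eigenvectorBasis hE with hv
  set s : Fin n → ℝ := fun l => A.singularValues (l : ℕ) with hs
  have hAA : ∀ l, LinearMap.adjoint A (A (v l)) = ((s l : ℂ) ^ 2) • v l := fun l => by
    refine (A.isSymmetric_adjoint_comp_self.apply_eigenvectorBasis hE l).trans ?_
    rw [← A.sq_singularValues_fin hE l, hv]
    push_cast
    rfl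
  have hin : ∀ k l, inner ℂ (A (v k)) (A (v l)) = if k = l then (s l : ℂ) ^ 2 else 0 := by
    intro k l
    rw [← LinearMap.adjoint_inner_right, hAA, inner_smul_right,
      orthonormal_iff_ite.1 v.orthonormal]
    simp
  have hon : Orthonormal ℂ ({l | s l ≠ 0}.domRestrict fun l => ((s l : ℂ)⁻¹) • A (v l)) := by
    rw [orthonormal_iff_ite]
    rintro ⟨k, hk⟩ ⟨l, hl⟩
    have hl' : (s l : ℂ) ≠ 0 := Complex.ofReal_ne_zero.2 hl
    simp only [Set.domRestrict_apply, inner_smul_left, inner_smul_right, hin, Subtype.mk.injEq]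
    split_ifs with h
    · subst h
      simp
      field_simp
    · simp
  obtain ⟨w, hw⟩ := hon.exists_orthonormalBasis_extension_of_card_eq (by simpa using hF)
  refine ⟨w, v, fun l => ⟨A.singularValues_nonneg l, ?_⟩⟩
  by_cases hl : s l = 0
  · have h := hin l l
    rw [if_pos rfl, hl, Complex.ofReal_zero, zero_pow two_ne_zero, inner_self_eq_zero] at h
    rw [h, hl, Complex.ofReal_zero, zero_smul]
  · rw [hw l hl, smul_smul, mul_inv_cancel₀ (Complex.ofReal_ne_zero.2 hl), one_smul]

theorem finrank_truncated {N : ℕ} (i : Fin N) :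
    Module.finrank ℂ (EuclideanSpace ℂ (Bits (Others i))) = 2 ^ (N - 1) := by
  rw [finrank_euclideanSpace, Fintype.card_fun, Fintype.card_fin, Fintype.card_subtype_compl,
    Fintype.card_fin]
  simp

theorem IsSVD.adjoint_apply {ι E F : Type*} [Fintype ι] [NormedAddCommGroup E]
    [InnerProductSpace ℂ E] [FiniteDimensional ℂ E] [NormedAddCommGroup F] [InnerProductSpace ℂ F]
    [FiniteDimensional ℂ F] {A : E →ₗ[ℂ] F} {σ : ι → ℝ} {w : OrthonormalBasis ι ℂ F}
    {v : OrthonormalBasis ι ℂ E} (h : IsSVD A σ w v) (l : ι) :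
    LinearMap.adjoint A (w l) = (σ l : ℂ) • v l := by
  classical
  refine v.repr.injective (PiLp.ext fun k => ?_)
  rw [v.repr_apply_apply, v.repr_apply_apply, LinearMap.adjoint_inner_right, (h k).2,
    inner_smul_left, inner_smul_right,
    orthonormal_iff_ite.1 v.orthonormal, orthonormal_iff_ite.1 w.orthonormal]
  split_ifs with hk
  · simp [hk]
  · simp

/-! ### The register -/

section Register

variable {N : ℕ}

/-- The projection onto `|0⟩` of the qubit `i`. -/
def zeroProj (i : Fin N) : QubitOp N := Matrix.diagonal fun a => if a i = 0 then 1 else 0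

theorem zeroProj_mul_self (i : Fin N) : zeroProj i * zeroProj i = zeroProj i := by
  simp [zeroProj, Matrix.diagonal_mul_diagonal]

theorem phaseRot_eq_diagonal (i : Fin N) (φ : ℝ) :
    phaseRot i φ = Matrix.diagonal fun a => if a i = 0 then phase φ else phase (-φ) := by
  have h : (-(Complex.I * (φ : ℂ))) • onSite i pauliZ = Matrix.diagonal fun a : Bits (Fin N) =>
      if a i = 0 then -(Complex.I * (φ : ℂ)) else Complex.I * (φ : ℂ) := by
    ext a b
    rw [Matrix.smul_apply, onSite, Matrix.diagonal_apply]
    by_cases hab : a = b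
    · subst hab
      rcases Fin.exists_fin_two.1 ⟨a i, rfl⟩ with h | h <;> simp [h, pauliZ]
    · rw [if_neg hab]
      split_ifs with hk
      -- Distinct labels agreeing off `i` differ at `i`, where the entry of `Z` is off-diagonal and
      -- vanishes.
      · have hi : a i ≠ b i := fun hi => hab (funext fun k => by
          by_cases hki : k = i
          · rw [hki, hi]
          · exact hk k hki)
        generalize a i = x at *
        generalize b i = y at *
        fin_cases x <;> fin_cases y <;> simp_all [pauliZ]
      · simp
  rw [phaseRot, h, Matrix.exp_diagonal, Pi.exp_def]
  congr 1
  ext a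
  split_ifs <;> simp [phase, Complex.exp_eq_exp_ℂ]

theorem phaseRot_eq_projRot (i : Fin N) (φ : ℝ) : phaseRot i φ = projRot (zeroProj i) φ := by
  rw [phaseRot_eq_diagonal, projRot, zeroProj, ← Matrix.diagonal_one, ← Matrix.diagonal_smul,
    ← Matrix.diagonal_smul, Matrix.diagonal_add]
  congr 1
  ext a
  by_cases h : a i = 0 <;> simp [h]

theorem ketZero_apply (j : Fin N) (a : Bits (Fin N)) (b : Bits (Others j)) :
    ketZero j a b = if (fun k : Others j => a k) = b then (if a j = 0 then 1 else 0) else 0 := by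
  rw [ketZero]
  by_cases h : (fun k : Others j => a k) = b
  · simp [← h]
  · rw [if_neg h, if_neg fun hc => h (funext hc.2)]

/-- The basis label extending `b` by `0` at the qubit `j`. -/
def extendZero (j : Fin N) (b : Bits (Others j)) : Bits (Fin N) :=
  fun k => if h : k = j then 0 else b ⟨k, h⟩

theorem extendZero_self (j : Fin N) (b : Bits (Others j)) : extendZero j b j = 0 := by
  simp [extendZero]

theorem extendZero_apply (j : Fin N) (b : Bits (Others j)) (k : Others j) :
    extendZero j b k = b k := by
  simp [extendZero, k.2]

/-- This form collapses sums over full labels, whereas `ketZero_apply` collapses sums over truncated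
ones. -/
theorem ketZero_apply_eq_extendZero (j : Fin N) (a : Bits (Fin N)) (b : Bits (Others j)) :
    ketZero j a b = if a = extendZero j b then 1 else 0 := by
  rw [ketZero]
  refine if_congr ⟨fun h => funext fun k => ?_, ?_⟩ rfl rfl
  · by_cases hk : k = j
    · rw [hk, h.1, extendZero_self]
    · rw [h.2 ⟨k, hk⟩]
      exact (extendZero_apply j b ⟨k, hk⟩).symm
  · rintro rfl
    exact ⟨extendZero_self j b, extendZero_apply j b⟩

theorem ketZero_mul_adj (j : Fin N) : ketZero j * (ketZero j)ᴴ = zeroProj j := by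
  ext a b
  simp only [Matrix.mul_apply, Matrix.conjTranspose_apply, ketZero_apply, zeroProj,
    Matrix.diagonal_apply, ite_mul, zero_mul, Finset.sum_ite_eq, Finset.mem_univ, if_true]
  by_cases hab : a = b
  · subst hab
    by_cases h : a j = 0 <;> simp [h]
  · rw [if_neg hab]
    by_cases ha : a j = 0
    · by_cases hb : b j = 0
      · have : (fun k : Others j => b k) ≠ fun k : Others j => a k := fun h =>
          hab (funext fun k => by
            by_cases hk : k = j
            · rw [hk, ha, hb]
            · exact (congrFun h ⟨k, hk⟩).symm)
        simp [this]
      · simp [hb]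
    · simp [ha]

theorem ketZero_adj_mul (j : Fin N) : (ketZero j)ᴴ * ketZero j = 1 := by
  ext b c
  simp only [Matrix.mul_apply, Matrix.conjTranspose_apply, ketZero_apply_eq_extendZero,
    Matrix.one_apply, mul_ite, mul_one, mul_zero, Finset.sum_ite_eq', Finset.mem_univ, if_true]
  by_cases hbc : b = c
  · simp [hbc]
  · have : extendZero j c ≠ extendZero j b := fun h => hbc (funext fun k => by
      rw [← extendZero_apply j b k, ← h, extendZero_apply])
    simp [hbc, this]

theorem ketZero_mulVec_apply_zero (j : Fin N) (x : Bits (Others j) → ℂ) :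
    (ketZero j *ᵥ x) 0 = x 0 := by
  simp only [Matrix.mulVec, dotProduct, ketZero_apply, ite_mul, zero_mul, Finset.sum_ite_eq,
    Finset.mem_univ, if_true, Pi.zero_apply, one_mul]
  rfl

theorem ketZero_mulVec_zeroState (j : Fin N) :
    ketZero j *ᵥ (zeroState j).ofLp = Pi.single 0 1 := by
  have h0 : extendZero j 0 = 0 := by
    ext1 k
    simp [extendZero]
  ext a
  rw [zeroState, PiLp.ofLp_single, Matrix.mulVec_single_one, Matrix.col_apply,
    ketZero_apply_eq_extendZero, h0, Pi.single_apply]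

theorem qspOTOC_eq_projWord (i j : Fin N) {U : QubitOp N} (hU : Uᴴ * U = 1) (d : ℕ)
    (φ : Fin (2 * d + 1) → ℝ) :
    qspOTOC i j U d φ = (phaseRot i (φ (Fin.last (2 * d))) *
      projWord (zeroProj j) (Uᴴ * zeroProj i * U) (phasePairs d φ)) 0 0 := by
  rw [qspOTOC, projWord, phasePairs, List.map_ofFn]
  have he : ∀ x y : ℝ, echo i j U x y =
      projRot (Uᴴ * zeroProj i * U) x * projRot (zeroProj j) y := fun x y => by
    rw [echo, phaseRot_eq_projRot, conj_projRot hU, phaseRot_eq_projRot]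
  simp only [he]
  rfl

theorem gram_mulVec {i j : Fin N} {U : QubitOp N} {ι : Type*} [Fintype ι] {σ : ι → ℝ}
    {w : OrthonormalBasis ι ℂ (EuclideanSpace ℂ (Bits (Others i)))}
    {v : OrthonormalBasis ι ℂ (EuclideanSpace ℂ (Bits (Others j)))}
    (h : IsSVD (truncPropLin i j U) σ w v) (l : ι) :
    ((truncProp i j U)ᴴ * truncProp i j U) *ᵥ (v l).ofLp = ((σ l : ℂ) ^ 2) • (v l).ofLp := by
  have h1 : truncProp i j U *ᵥ (v l).ofLp = (σ l : ℂ) • (w l).ofLp :=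
    congrArg WithLp.ofLp (h l).2
  have h2 : (truncProp i j U)ᴴ *ᵥ (w l).ofLp = (σ l : ℂ) • (v l).ofLp := by
    have := h.adjoint_apply l
    rw [truncPropLin, ← Matrix.toEuclideanLin_conjTranspose_eq_adjoint] at this
    exact congrArg WithLp.ofLp this
  rw [← Matrix.mulVec_mulVec, h1, Matrix.mulVec_smul, h2, smul_smul, sq]

/-- The QSP-OTOC is the spectral sum of its QSP polynomial. -/
theorem qspOTOC_eq_sum {i j : Fin N} {U : QubitOp N} (hU : U ∈ Matrix.unitaryGroup (Bits (Fin N)) ℂ)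
    {ι : Type*} [Fintype ι] {σ : ι → ℝ}
    {w : OrthonormalBasis ι ℂ (EuclideanSpace ℂ (Bits (Others i)))}
    {v : OrthonormalBasis ι ℂ (EuclideanSpace ℂ (Bits (Others j)))}
    (h : IsSVD (truncPropLin i j U) σ w v) (d : ℕ) (φ : Fin (2 * d + 1) → ℝ) :
    qspOTOC i j U d φ = ∑ l, (weight v l : ℂ) * (qspPoly d φ).eval ((σ l : ℝ) : ℂ) := by
  have hU1 : Uᴴ * U = 1 := Matrix.mem_unitaryGroup_iff'.1 hU
  have hU2 : U * Uᴴ = 1 := Matrix.mem_unitaryGroup_iff.1 hU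
  have hdiag : ∀ f : Bits (Fin N) → ℂ, Matrix.diagonal f *ᵥ Pi.single 0 1 = f 0 • Pi.single 0 1 := by
    intro f
    ext a
    rw [Matrix.mulVec_diagonal]
    by_cases ha : a = 0 <;> simp [ha]
  have hdiag' : ∀ f : Bits (Fin N) → ℂ,
      Pi.single 0 1 ᵥ* Matrix.diagonal f = f 0 • Pi.single 0 1 := by
    intro f
    ext a
    rw [Matrix.vecMul_diagonal]
    by_cases ha : a = 0 <;> simp [ha]
  rw [qspOTOC_eq_projWord i j hU1, apply_eq_dotProduct_mulVec (_ * _),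
    vacuum_amplitude (zeroProj_mul_self j) (conj_mul_self hU2 (zeroProj_mul_self i))
      (u := fun l => ketZero j *ᵥ (v l).ofLp) (μ := fun l => ((σ l : ℂ)) ^ 2)
      (a := fun l => inner ℂ (v l) (zeroState j))]
  · refine Finset.sum_congr rfl fun l _ => ?_
    rw [eval_qspPoly]
    congr 1
    have h1 : inner ℂ (v l) (zeroState j) = starRingEnd ℂ ((v l).ofLp 0) := by
      rw [zeroState, EuclideanSpace.inner_single_right, one_mul]
    rw [single_one_dotProduct, ketZero_mulVec_apply_zero, weight, h1, mul_comm, Complex.mul_conj,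
      Complex.normSq_eq_norm_sq, RCLike.norm_conj]
  · rw [zeroProj, hdiag]
    simp
  · rw [zeroProj, hdiag']
    simp
  · intro l
    have hg := gram_mulVec h l
    have hK := ketZero_adj_mul j
    -- Writing each projection as `K K†` turns `E F E K` into `K A† A`, so the isometry `K` carries
    -- right singular vectors to eigenvectors of `E F E`.
    have e : zeroProj j * (Uᴴ * zeroProj i * U) * zeroProj j * ketZero j =
        ketZero j * ((truncProp i j U)ᴴ * truncProp i j U) := by
      rw [← ketZero_mul_adj j, ← ketZero_mul_adj i, truncProp]
      simp only [Matrix.conjTranspose_mul, Matrix.conjTranspose_conjTranspose, Matrix.mul_assoc, hK,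
        Matrix.mul_one]
    rw [Matrix.mulVec_mulVec, e, ← Matrix.mulVec_mulVec, hg, Matrix.mulVec_smul]
  · have hz := v.sum_repr' (zeroState j)
    have := congrArg (fun x => ketZero j *ᵥ (WithLp.ofLp x)) hz
    simp only [ketZero_mulVec_zeroState, WithLp.ofLp_sum, WithLp.ofLp_smul, Matrix.mulVec_sum,
      Matrix.mulVec_smul] at this
    exact this.symm
  -- The leading rotation acts at site `i` while `E` lives at `j`; only its phase on the vacuum
  -- matters, so `i = j` and `i ≠ j` need no distinction.
  · rw [phaseRot_eq_diagonal, hdiag']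
    simp

end Register

end QSPOTOC

/-! ### Assembly of the main theorem. -/

theorem mainTheorem2 :
    ∃ P : (d : ℕ) → (Fin (2 * d + 1) → ℝ) → ℂ[X],
      -- `P d φ` is the QSP polynomial: degree at most `2d`, even, bounded, and equal to the
      -- single-qubit QSP amplitude at the signal `cos (θ / 2)`.
      (∀ (d : ℕ) (φ : Fin (2 * d + 1) → ℝ),
        (P d φ).natDegree ≤ 2 * d ∧
        (P d φ).comp (-Polynomial.X) = P d φ ∧
        (∀ x : ℝ, |x| ≤ 1 → ‖(P d φ).eval (x : ℂ)‖ ≤ 1) ∧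
        (∀ θ : ℝ, (P d φ).eval ((Real.cos (θ / 2) : ℝ) : ℂ) = QSPOTOC.qspAmplitude d φ θ)) ∧
      -- a singular value decomposition of `A_{i,j}` exists, and every one of them represents
      -- the QSP-OTOC.
      (∀ (N : ℕ) (i j : Fin N) (U : QSPOTOC.QubitOp N),
        U ∈ Matrix.unitaryGroup (QSPOTOC.Bits (Fin N)) ℂ →
        (∃ (w : OrthonormalBasis (Fin (2 ^ (N - 1))) ℂ
              (EuclideanSpace ℂ (QSPOTOC.Bits (QSPOTOC.Others i))))
           (v : OrthonormalBasis (Fin (2 ^ (N - 1))) ℂ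
              (EuclideanSpace ℂ (QSPOTOC.Bits (QSPOTOC.Others j)))),
          QSPOTOC.IsSVD (QSPOTOC.truncPropLin i j U)
            (fun l : Fin (2 ^ (N - 1)) =>
              (QSPOTOC.truncPropLin i j U).singularValues (l : ℕ)) w v) ∧
        (∀ (σ : Fin (2 ^ (N - 1)) → ℝ)
           (w : OrthonormalBasis (Fin (2 ^ (N - 1))) ℂ
              (EuclideanSpace ℂ (QSPOTOC.Bits (QSPOTOC.Others i))))
           (v : OrthonormalBasis (Fin (2 ^ (N - 1))) ℂ
              (EuclideanSpace ℂ (QSPOTOC.Bits (QSPOTOC.Others j)))),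
          QSPOTOC.IsSVD (QSPOTOC.truncPropLin i j U) σ w v →
          ∀ (d : ℕ) (φ : Fin (2 * d + 1) → ℝ),
            QSPOTOC.qspOTOC i j U d φ =
              ∑ l, (QSPOTOC.weight v l : ℂ) * (P d φ).eval ((σ l : ℝ) : ℂ))) ∧
      -- every real even polynomial of degree at most `2d` bounded by `1` on `[-1, 1]` is the
      -- real part of some `P d φ`, so that the real part of the QSP-OTOC is its spectral sum.
      (∀ (d : ℕ) (p : Polynomial ℝ),
        p.natDegree ≤ 2 * d →
        p.comp (-Polynomial.X) = p →
        (∀ x : ℝ, |x| ≤ 1 → |p.eval x| ≤ 1) →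
        ∃ φ : Fin (2 * d + 1) → ℝ,
          (∀ x : ℝ, ((P d φ).eval (x : ℂ)).re = p.eval x) ∧
          (∀ (N : ℕ) (i j : Fin N) (U : QSPOTOC.QubitOp N),
            U ∈ Matrix.unitaryGroup (QSPOTOC.Bits (Fin N)) ℂ →
            ∀ (σ : Fin (2 ^ (N - 1)) → ℝ)
              (w : OrthonormalBasis (Fin (2 ^ (N - 1))) ℂ
                (EuclideanSpace ℂ (QSPOTOC.Bits (QSPOTOC.Others i))))
              (v : OrthonormalBasis (Fin (2 ^ (N - 1))) ℂ
                (EuclideanSpace ℂ (QSPOTOC.Bits (QSPOTOC.Others j)))),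
              QSPOTOC.IsSVD (QSPOTOC.truncPropLin i j U) σ w v →
              (QSPOTOC.qspOTOC i j U d φ).re = ∑ l, QSPOTOC.weight v l * p.eval (σ l))) ∧
      -- under the additional boundedness constraints off `[-1, 1]` it equals some `P d φ`, and the
      -- QSP-OTOC itself is its spectral sum.
      (∀ (d : ℕ) (p : Polynomial ℝ),
        p.natDegree ≤ 2 * d →
        p.comp (-Polynomial.X) = p →
        (∀ x : ℝ, |x| ≤ 1 → |p.eval x| ≤ 1) →
        (∀ x : ℝ, 1 ≤ |x| → 1 ≤ |p.eval x|) →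
        (∀ x : ℝ, 1 ≤ ‖Polynomial.aeval (Complex.I * (x : ℂ)) p‖) →
        ∃ φ : Fin (2 * d + 1) → ℝ,
          P d φ = p.map (algebraMap ℝ ℂ) ∧
          (∀ (N : ℕ) (i j : Fin N) (U : QSPOTOC.QubitOp N),
            U ∈ Matrix.unitaryGroup (QSPOTOC.Bits (Fin N)) ℂ →
            ∀ (σ : Fin (2 ^ (N - 1)) → ℝ)
              (w : OrthonormalBasis (Fin (2 ^ (N - 1))) ℂ
                (EuclideanSpace ℂ (QSPOTOC.Bits (QSPOTOC.Others i))))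
              (v : OrthonormalBasis (Fin (2 ^ (N - 1))) ℂ
                (EuclideanSpace ℂ (QSPOTOC.Bits (QSPOTOC.Others j)))),
              QSPOTOC.IsSVD (QSPOTOC.truncPropLin i j U) σ w v →
              QSPOTOC.qspOTOC i j U d φ =
                ((∑ l, QSPOTOC.weight v l * p.eval (σ l) : ℝ) : ℂ))) := by
  refine ⟨QSPOTOC.qspPoly, fun d φ => ⟨QSPOTOC.natDegree_qspPoly d φ,
    QSPOTOC.qspPoly_comp_neg_X d φ, fun x hx => ?_, fun θ => ?_⟩, fun N i j U hU => ⟨?_, ?_⟩,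
    fun d p hd he hb => ?_, fun d p hd he hb hr hi => ?_⟩
  · have h := QSPOTOC.norm_qspAmplitude_le d φ (2 * Real.arccos x)
    rw [QSPOTOC.qspAmplitude_eq, mul_div_cancel_left₀ _ two_ne_zero,
      Real.cos_arccos (abs_le.1 hx).1 (abs_le.1 hx).2] at h
    rwa [QSPOTOC.eval_qspPoly]
  · rw [QSPOTOC.eval_qspPoly, QSPOTOC.qspAmplitude_eq]
  · exact QSPOTOC.exists_isSVD (QSPOTOC.finrank_truncated j) (QSPOTOC.finrank_truncated i) _
  · exact fun σ w v h d φ => QSPOTOC.qspOTOC_eq_sum hU h d φ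
  · obtain ⟨φ, hφ⟩ := QSPOTOC.exists_re_qspPoly_eq hd he hb
    refine ⟨φ, hφ, fun N i j U hU σ w v h => ?_⟩
    rw [QSPOTOC.qspOTOC_eq_sum hU h, Complex.re_sum]
    exact Finset.sum_congr rfl fun l _ => by rw [Complex.re_ofReal_mul, hφ]
  · obtain ⟨φ, hφ⟩ := QSPOTOC.exists_qspPoly_eq hd he hb hr hi
    refine ⟨φ, hφ, fun N i j U hU σ w v h => ?_⟩
    rw [QSPOTOC.qspOTOC_eq_sum hU h, hφ, Complex.ofReal_sum]
    exact Finset.sum_congr rfl fun l _ => by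
      rw [QSPOTOC.eval_map_ofReal, Complex.ofReal_mul]
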